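/- Notation. Write $q=e^{2\pi i\tau}$ with $\operatorname{Im}\tau>0$. For integers $0\le s\le m$ put $$\Phi_1^{[m;s]}(\tau,z_1,z_2)=\sum_{j\in\mathbb Z}\frac{e^{2\pi i(m+1)j(z_1+z_2)-2\pi i s z_1}q^{j^2(m+1)-js}}{1-e^{2\pi i z_1}q^j},$$ $$\Phi^{[m;s]}(\tau,z_1,z_2,t)=e^{2\pi i(m+1)t}\bigl(\Phi_1^{[m;s]}(\tau,z_1,z_2)-\Phi_1^{[m;s]}(\tau,-z_2,-z_1)\bigr).$$ Let $$\Theta_{j,n}(\tau,z)=\sum_{k\in\mathbb Z}e^{2\pi i n z(k+\frac j{2n})}q^{n(k+\frac j{2n})^2},\qquad E(x)=2\int_0^xe^{-\pi u^2}du,$$ $$R_{j;m+1}(\tau,v)=\sum_{n\equiv -j\ (2(m+1))}\Bigl(\operatorname{sgn}\bigl(n+\tfrac12+j-2(m+1)\bigr)-E\Bigl(\bigl(n+2(m+1)\tfrac{\operatorname{Im}v}{\operatorname{Im}\tau}\bigr)\sqrt{\tfrac{\operatorname{Im}\tau}{m+1}}\Bigr)\Bigr)e^{-\frac{\pi i n^2}{2(m+1)}\tau-2\pi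 i n v},$$ and $$\widetilde\Phi^{[m;s]}=\Phi^{[m;s]}+\tfrac12e^{2\pi i(m+1)t}\sum_{j=-s}^{-s+2m+1}R_{j;m+1}\bigl(\tau,\tfrac{z_1-z_2}2\bigr)\,(\Theta_{j,m+1}-\Theta_{-j,m+1})(\tau,z_1+z_2).$$ For a positive integer $M$, $\epsilon,\epsilon'\in\{0,\frac12\}$ and $a,b\in\epsilon'+\mathbb Z$ put $$\widetilde\Psi^{[M,m,s;\epsilon]}_{a,b;\epsilon'}(\tau,z_1,z_2,t)=q^{\frac{(m+1)ab}M}e^{\frac{2\pi i(m+1)}M(bz_1+az_2)}\,\widetilde\Phi^{[m;s]}\bigl(M\tau,z_1+a\tau+\epsilon,z_2+b\tau+\epsilon,\tfrac tM\bigr).$$ Let $\widehat R^{(0)}_0=\widehat R^-$ and $\widehat R^{(1/2)}_0=\widehat R^+$ be the affine superdenominator and denominator of $\widehat{s\ell}_{2|1}$, $$\widehat R^{\pm}(\tau,z_1,z_2,t)=e^{2\pi i t}\,\frac{\prod_{n\ge1}(1-q^n)^2(1-e^{2\pi i(z_1+z_2)}q^{n-1})(1-e^{-2\pi i(z_1+z_2)}q^n)}{\prod_{i=1,2}\prod_{n\ge1}(1\pm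 e^{2\pi i z_i}q^{n-1})(1\pm e^{-2\pi i z_i}q^n)},$$ and let $\widehat R^{(\epsilon)}_{1/2}(\tau,z_1,z_2,t)=\widehat R^{(\epsilon)}_{0}\bigl(\tau,z_1+\frac\tau2,z_2+\frac\tau2,t+\frac{z_1+z_2}2+\frac\tau4\bigr)$ be their twists. The modified normalized characters, supercharacters and their twisted versions are $$\widetilde{ch}^{[M,m,s;\epsilon]}_{j,k;\epsilon'}=\widetilde\Psi^{[M,m,s;\epsilon]}_{j,k;\epsilon'}\big/\widehat R^{(\epsilon)}_{\epsilon'}\qquad(j,k\in\epsilon'+\mathbb Z,\ 0\le j,k<M).$$ **Theorem 2.9.** Let $M$ be a positive integer and $m$ a non-negative integer such that $\gcd(M,2m+2)=1$ if $m>0$, and let $s\in\mathbb Z$, $0\le s\le m$. Then for all $\epsilon,\epsilon'\in\{0,\frac12\}$ and all $j,k\in\epsilon'+\mathbb Z$ with $0\le j,k<M$: $$\widetilde{ch}^{[M,m,s;\epsilon]}_{j,k;\epsilon'}\Bigl(-\frac1\tau,\frac{z_1}\tau,\frac{z_2}\tau,t-\frac{z_1z_2}\tau\Bigr)=(-1)^{4\epsilon\epsilon'}\frac1M\sum_{\substack{a,b\in\epsilon+\mathbb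 Z\\0\le a,b<M}}e^{-\frac{2\pi i(m+1)}M(ak+bj)}\,\widetilde{ch}^{[M,m,s;\epsilon']}_{a,b;\epsilon}(\tau,z_1,z_2,t),$$ $$\widetilde{ch}^{[M,m,s;\epsilon]}_{j,k;\epsilon'}(\tau+1,z_1,z_2,t)=e^{2\pi i\frac{(m+1)jk}M-\pi i\epsilon'}\,\widetilde{ch}^{[M,m,s;|\epsilon-\epsilon'|]}_{j,k;\epsilon'}(\tau,z_1,z_2,t).$$ Here $\operatorname{Im}\tau>0$, $t\in\mathbb C$, and $(z_1,z_2)$ is any point at which no denominator vanishes, that is, $z_1+z_2\notin\mathbb Z+\tau\mathbb Z$ and, for $i=1,2$, $z_i\notin\epsilon'+\epsilon\tau+\mathbb Z+\tau\mathbb Z$ in the first formula, $z_i\notin|\epsilon-\epsilon'|+\epsilon'\tau+\mathbb Z+\tau\mathbb Z$ in the second. Consequently, for fixed $M,m,s$, the $\mathbb C$-span of all these functions (over all $\epsilon,\epsilon',j,k$) is invariant under the action $\begin{pmatrix}a&b\\c&d\end{pmatrix}\cdot(\tau,z_1,z_2,t)=\bigl(\frac{a\tau+b}{c\tau+d},\frac{z_1}{c\tau+d},\frac{z_2}{c\tau+d},t-\frac{cz_1z_2}{c\tau+d}\bigr)$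 of $SL_2(\mathbb Z)$, as functions on the set where $\operatorname{Im}\tau>0$, $z_1,z_2\notin\frac12(\mathbb Z+\tau\mathbb Z)$ and $z_1+z_2\notin\mathbb Z+\tau\mathbb Z$. -/

import Mathlib

noncomputable section

namespace SL21

/-- `ex w = e^{2 π i w}`. -/
def ex (w : ℂ) : ℂ := Complex.exp (2 * (Real.pi : ℂ) * Complex.I * w)

/-- The classical theta function `Θ_{j,n}(τ, z, 0)` of degree `n`. -/
def Theta (j : ℤ) (n : ℕ) (τ z : ℂ) : ℂ :=
  ∑' k : ℤ, ex ((n : ℂ) * z * ((k : ℂ) + (j : ℂ) / (2 * (n : ℂ)))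
    + (n : ℂ) * ((k : ℂ) + (j : ℂ) / (2 * (n : ℂ))) ^ 2 * τ)

/-- The rank-one mock theta function `Φ_1^{[m;s]}(τ, z₁, z₂)`, with `q = e^{2 π i τ}`. -/
def Phi1 (m s : ℕ) (τ z₁ z₂ : ℂ) : ℂ :=
  ∑' j : ℤ, ex (((m : ℂ) + 1) * (j : ℂ) * (z₁ + z₂) - (s : ℂ) * z₁
      + ((j : ℂ) ^ 2 * ((m : ℂ) + 1) - (j : ℂ) * (s : ℂ)) * τ)
    / (1 - ex (z₁ + (j : ℂ) * τ))

/-- The function `Φ^{[m;s]}(τ, z₁, z₂, t)`: the numerator of the supercharacter of the integrable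
module of highest weight `(m - s) Λ₀ + s Λ₂`. -/
def Phi (m s : ℕ) (τ z₁ z₂ t : ℂ) : ℂ :=
  ex (((m : ℂ) + 1) * t) * (Phi1 m s τ z₁ z₂ - Phi1 m s τ (-z₂) (-z₁))

/-- `E(x) = 2 ∫_0^x e^{-π u²} du`. -/
def gaussE (x : ℝ) : ℝ := 2 * ∫ u in (0 : ℝ)..x, Real.exp (-Real.pi * u ^ 2)

/-- The term of index `n` of the series that defines `R_{j;m+1}(τ, v)`. -/
def zwegersTerm (m : ℕ) (j : ℤ) (τ v : ℂ) (n : ℤ) : ℂ :=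
  ((Real.sign ((n : ℝ) + 1 / 2 + (j : ℝ) - 2 * ((m : ℝ) + 1))
      - gaussE (((n : ℝ) + 2 * ((m : ℝ) + 1) * (v.im / τ.im)) * Real.sqrt (τ.im / ((m : ℝ) + 1)))
      : ℝ) : ℂ)
    * Complex.exp (-((Real.pi : ℂ) * Complex.I * (n : ℂ) ^ 2 / (2 * ((m : ℂ) + 1))) * τ
        - 2 * (Real.pi : ℂ) * Complex.I * (n : ℂ) * v)

/-- The modified Zwegers function `R_{j;m+1}(τ, v)`: the sum over all integers
`n ≡ -j mod 2(m+1)`, written as `n = 2(m+1) l - j` with `l ∈ ℤ`. -/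
def zwegersR (m : ℕ) (j : ℤ) (τ v : ℂ) : ℂ :=
  ∑' l : ℤ, zwegersTerm m j τ v (2 * ((m : ℤ) + 1) * l - j)

/-- The real analytic correction `Φ_add^{[m;s]}`. -/
def PhiAdd (m s : ℕ) (τ z₁ z₂ t : ℂ) : ℂ :=
  1 / 2 * ex (((m : ℂ) + 1) * t)
    * ∑ j ∈ Finset.Icc (-(s : ℤ)) (-(s : ℤ) + 2 * (m : ℤ) + 1),
        zwegersR m j τ ((z₁ - z₂) / 2)
          * (Theta j (m + 1) τ (z₁ + z₂) - Theta (-j) (m + 1) τ (z₁ + z₂))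

/-- The modification `Φ~^{[m;s]} = Φ^{[m;s]} + Φ_add^{[m;s]}`. -/
def PhiTilde (m s : ℕ) (τ z₁ z₂ t : ℂ) : ℂ :=
  Phi m s τ z₁ z₂ t + PhiAdd m s τ z₁ z₂ t

/-- `Ψ~^{[M,m,s;ε]}_{a,b;ε'}(τ, z₁, z₂, t)`; the lower index `ε'` (the class of `a` and `b`
modulo `ℤ`) does not occur in the formula. -/
def PsiTilde (M m s : ℕ) (ε a b : ℝ) (τ z₁ z₂ t : ℂ) : ℂ :=
  ex (((m : ℂ) + 1) * (a : ℂ) * (b : ℂ) / (M : ℂ) * τ)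
    * ex (((m : ℂ) + 1) / (M : ℂ) * ((b : ℂ) * z₁ + (a : ℂ) * z₂))
    * PhiTilde m s ((M : ℂ) * τ) (z₁ + (a : ℂ) * τ + (ε : ℂ)) (z₂ + (b : ℂ) * τ + (ε : ℂ))
        (t / (M : ℂ))

/-- `∏_{n ≥ 0} (1 - x qⁿ) (1 - x⁻¹ qⁿ⁺¹)` with `x = e^{2 π i w}` and `q = e^{2 π i τ}`. -/
def rootProd (τ w : ℂ) : ℂ :=
  ∏' n : ℕ, (1 - ex (w + (n : ℂ) * τ)) * (1 - ex (-w + ((n : ℂ) + 1) * τ))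

/-- The affine superdenominator `R^-` (`ε = 0`) and denominator `R^+` (`ε = 1/2`) of `sl(2|1)^`,
`e^{ρ} ∏_{α even} (1 - e^{-α}) / ∏_{α odd} (1 ± e^{-α})` over the positive affine roots, in the
coordinates `e^{-α₁} = e^{2 π i z₁}`, `e^{-α₂} = e^{2 π i z₂}`, `e^{-δ} = q`, `e^{ρ} = e^{Λ₀} =
e^{2 π i t}`.  The even roots are `n δ` (of multiplicity 2) and those in `±(α₁ + α₂) + ℤ δ`, the
odd roots are those in `±α₁ + ℤ δ` and in `±α₂ + ℤ δ`.  The shift of `z₁, z₂` by `ε = 1/2` in the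
odd factors changes `1 - e^{-α}` to `1 + e^{-α}`. -/
def denom (ε : ℝ) (τ z₁ z₂ t : ℂ) : ℂ :=
  ex t * (∏' n : ℕ, (1 - ex (((n : ℂ) + 1) * τ))) ^ 2 * rootProd τ (z₁ + z₂)
    / (rootProd τ (z₁ + (ε : ℂ)) * rootProd τ (z₂ + (ε : ℂ)))

/-- The (super)denominators `R^{(ε)}_{ε'}`: untwisted for `ε' = 0`, and for `ε' = 1/2` twisted by
`t_ξ`, `ξ = -(α₁ + α₂)/2`, which sends `e^{-αᵢ}` to `e^{-αᵢ} q^{1/2}` and `e^{Λ₀}` to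
`e^{Λ₀} e^{ξ} q^{1/4}`. -/
def Rhat (ε ε' : ℝ) (τ z₁ z₂ t : ℂ) : ℂ :=
  denom ε τ (z₁ + (ε' : ℂ) * τ) (z₂ + (ε' : ℂ) * τ)
    (t + (ε' : ℂ) * (z₁ + z₂) + (ε' : ℂ) ^ 2 * τ)

/-- The modified normalized (twisted) (super)characters `ch~^{[M,m,s;ε]}_{j,k;ε'}`. -/
def chTilde (M m s : ℕ) (ε ε' j k : ℝ) (τ z₁ z₂ t : ℂ) : ℂ :=
  PsiTilde M m s ε j k τ z₁ z₂ t / Rhat ε ε' τ z₁ z₂ t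

/-- The two values `0` and `1/2` of `ε` and `ε'`. -/
def halves : Finset ℝ := {0, 1 / 2}

/-- For `ε ∈ {0, 1/2}` the set `{a ∈ ε + ℤ | 0 ≤ a < M}`. -/
def indices (M : ℕ) (ε : ℝ) : Finset ℝ :=
  (Finset.range M).image fun n : ℕ => (n : ℝ) + ε

/-- `w ∈ ℤ + τ ℤ`. -/
def InLattice (τ w : ℂ) : Prop := ∃ p r : ℤ, w = (p : ℂ) + (r : ℂ) * τ

/-- The points at which no denominator in the formula for `ch~^{[M,m,s;ε]}_{j,k;ε'}` vanishes:
`Ψ~` and `R^{(ε)}_{ε'}` have poles only where `z₁` or `z₂` lies in `ε + ε' τ + ℤ + τ ℤ`, and the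
zeros of `R^{(ε)}_{ε'}` outside of its poles are at `z₁ + z₂ ∈ ℤ + τ ℤ`. -/
def IsRegular (ε ε' : ℝ) (τ z₁ z₂ : ℂ) : Prop :=
  ¬ InLattice τ (z₁ + (ε : ℂ) + (ε' : ℂ) * τ) ∧ ¬ InLattice τ (z₂ + (ε : ℂ) + (ε' : ℂ) * τ) ∧
    ¬ InLattice τ (z₁ + z₂)

end SL21

end

noncomputable section

namespace SL21

open Complex Filter Topology MeasureTheory ModularGroup

/-! The modified numerator is a lattice sum that is visibly modular. For `τ` in the upper half plane
the series `∑_λ exp(-πκ|z₁+λ|²/Im τ) χ(λ)/(z₁+λ)` over `λ ∈ ℤτ+ℤ`, with `χ` the unitary character of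
the lattice determined by `z₂` (`latTerm`), converges absolutely, and a change of basis of the
lattice only permutes its terms, up to the factor `τ` under `τ ↦ -1/τ`. `PhiTilde_eq` writes the
modified numerator as an exponential in `t` times two such sums with `κ = m+1`, one with poles in
`z₁` and one with poles in `z₂`; `s` disappears.

The bridge is `tsum_gaussTerm_div`. The theta-like sum `∑_n exp(-(π/ρ)(w+n)² + 2πib(w+n))` is
integrated over `b > r` twice: termwise it yields the pole terms `1/(w+n)`, and after Poisson
summation it yields coefficients `1 - E`. Writing `1 - E = (1 - sgn) + (sgn - E)` separates a
geometric series, which is a term of `Phi1`, from a series that converges for all `w`. Summed over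
the rows `w = z₁ + jτ`, the latter factors into the products of `R` and `Θ` in the correction
(`tsum_errTerm`).

For level `M` the translated sums are partial sums over the lattice of `τ` with `κ = (m+1)/M`. The
finite Fourier sum on the right of the first formula glues residue classes together and, by
orthogonality of characters modulo `M`, keeps exactly the terms of the left side (`psiSum_S`); `τ ↦
τ+1` is a shear (`psiHalf_T`).

The denominators are quotients of theta functions. The Jacobi triple product and the functional
equation of `jacobiTheta₂` give their behaviour, and a limit at the zero of the theta function
supplies the factor `∏(1-qⁿ)²` (`qProd_ex_S`). The factors `τ` of numerator and denominator cancel.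
Invariance of the span follows because `S` and `T` generate the modular group. -/

/-! ### Exponentials, Gaussian summability and Poisson summation -/

theorem ex_add (a b : ℂ) : ex (a + b) = ex a * ex b := by
  simp only [ex, mul_add, Complex.exp_add]

theorem ex_sub (a b : ℂ) : ex (a - b) = ex a / ex b := by
  simp only [ex, mul_sub, Complex.exp_sub]

theorem ex_neg (a : ℂ) : ex (-a) = (ex a)⁻¹ := by
  simp only [ex, mul_neg, Complex.exp_neg]

theorem ex_ne_zero (a : ℂ) : ex a ≠ 0 := Complex.exp_ne_zero _

theorem ex_zero : ex 0 = 1 := by simp [ex]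

theorem ex_int (n : ℤ) : ex n = 1 := by
  rw [ex, Complex.exp_eq_one_iff]
  exact ⟨n, by ring⟩

theorem ex_add_int (a : ℂ) (n : ℤ) : ex (a + n) = ex a := by
  rw [ex_add, ex_int, mul_one]

theorem ex_eq_of_sub_int {a b : ℂ} (n : ℤ) (h : a = b + n) : ex a = ex b := by
  rw [h, ex_add_int]

theorem norm_ex (a : ℂ) : ‖ex a‖ = Real.exp (-(2 * Real.pi * a.im)) := by
  rw [ex, Complex.norm_exp]
  congr 1
  simp [Complex.mul_re, Complex.mul_im]

theorem ex_eq_one_iff (a : ℂ) : ex a = 1 ↔ ∃ n : ℤ, a = n := by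
  rw [ex, Complex.exp_eq_one_iff]
  have h : (2 * (Real.pi : ℂ) * I) ≠ 0 := Complex.two_pi_I_ne_zero
  constructor
  · rintro ⟨n, hn⟩
    refine ⟨n, mul_left_cancel₀ h ?_⟩
    rw [hn]; ring
  · rintro ⟨n, rfl⟩
    exact ⟨n, by ring⟩

theorem ex_nat_mul (n : ℕ) (a : ℂ) : ex (n * a) = ex a ^ n := by
  rw [ex, ex, ← Complex.exp_nat_mul]
  congr 1; ring

theorem ex_int_mul (n : ℤ) (a : ℂ) : ex (n * a) = ex a ^ n := by
  rw [ex, ex, ← Complex.exp_int_mul]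
  congr 1; ring

theorem continuous_ex : Continuous ex := by
  unfold ex; fun_prop

/-- Real Gaussians with a linear term are summable over `ℤ`. -/
theorem summable_real_gaussian {a : ℝ} (ha : 0 < a) (b c : ℝ) :
    Summable fun n : ℤ => Real.exp (-a * (n : ℝ) ^ 2 + b * n + c) := by
  have h := (summable_jacobiTheta₂_term_iff (-(b / (2 * Real.pi) : ℝ) * I) ((a / Real.pi : ℝ) * I)).2
    (by simpa using div_pos ha Real.pi_pos)
  refine (h.norm.mul_right (Real.exp c)).congr fun n => ?_
  rw [norm_jacobiTheta₂_term, ← Real.exp_add]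
  congr 1
  have := Real.pi_pos.ne'
  simp only [Complex.mul_im, Complex.ofReal_re, Complex.I_im, Complex.ofReal_im, Complex.I_re,
    Complex.neg_re, Complex.neg_im]
  field_simp
  ring

/-- Poisson summation: the left side is a modulated Gaussian made periodic in `w`, the right side
its Fourier series. Completing the square in the dual series and replacing `n` by `-n` brings the
Mathlib formula to this shape. -/
theorem tsum_gaussian_poisson {ρ : ℝ} (hρ : 0 < ρ) (r : ℝ) (w : ℂ) :
    ∑' n : ℤ, Complex.exp (-(Real.pi / ρ) * (w + n) ^ 2 + 2 * Real.pi * I * r * (w + n)) =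
      (Real.sqrt ρ : ℂ) * ∑' k : ℤ, (Real.exp (-Real.pi * ρ * (r - k) ^ 2) : ℂ) * ex (k * w) := by
  have hρ' : (ρ : ℂ) ≠ 0 := by exact_mod_cast hρ.ne'
  have h := Complex.tsum_exp_neg_quadratic (a := ρ) (by simpa using hρ) (ρ * r + I * w)
  have hs : (ρ : ℂ) ^ (1 / 2 : ℂ) = (Real.sqrt ρ : ℂ) := by
    rw [Real.sqrt_eq_rpow, Complex.ofReal_cpow hρ.le]; norm_num
  have hs0 : (Real.sqrt ρ : ℂ) ≠ 0 := by exact_mod_cast (Real.sqrt_pos.2 hρ).ne'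
  rw [hs] at h
  have h1 : ∑' k : ℤ, (Real.exp (-Real.pi * ρ * (r - k) ^ 2) : ℂ) * ex (k * w) =
      Complex.exp (-Real.pi * ρ * r ^ 2) *
        ∑' n : ℤ, Complex.exp (-Real.pi * ρ * n ^ 2 + 2 * Real.pi * (ρ * r + I * w) * n) := by
    rw [← tsum_mul_left]
    refine tsum_congr fun n => ?_
    rw [Complex.ofReal_exp, ex, ← Complex.exp_add, ← Complex.exp_add]
    congr 1
    push_cast
    ring
  rw [h1, h, ← mul_assoc, ← mul_assoc, mul_comm (Real.sqrt ρ : ℂ), mul_assoc (cexp _),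
    mul_one_div_cancel hs0, mul_one, ← tsum_mul_left,
    ← (Equiv.neg ℤ).tsum_eq (fun n : ℤ => cexp (-Real.pi * ρ * r ^ 2) * _)]
  refine tsum_congr fun n => ?_
  rw [← Complex.exp_add]
  congr 1
  simp only [Equiv.neg_apply]
  push_cast
  field_simp
  linear_combination (-2 * w * n + 2 * w * ρ * r * I + w ^ 2 * (I ^ 2 - 1) + ρ ^ 2 * r ^ 2) * I_sq

/-! ### The error function and its distance from the sign function -/

theorem hasDerivAt_gaussE (x : ℝ) : HasDerivAt gaussE (2 * Real.exp (-Real.pi * x ^ 2)) x := by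
  have hc : Continuous fun u : ℝ => Real.exp (-Real.pi * u ^ 2) := by fun_prop
  exact (intervalIntegral.integral_hasDerivAt_right (hc.intervalIntegrable _ _)
    (hc.stronglyMeasurableAtFilter _ _) hc.continuousAt).const_mul 2

theorem integrable_gauss : Integrable fun u : ℝ => Real.exp (-Real.pi * u ^ 2) :=
  integrable_exp_neg_mul_sq Real.pi_pos

theorem integral_gauss_Ioi_zero : ∫ u in Set.Ioi (0 : ℝ), Real.exp (-Real.pi * u ^ 2) = 1 / 2 := by
  rw [integral_gaussian_Ioi, div_self Real.pi_pos.ne', Real.sqrt_one]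

theorem one_sub_gaussE (x : ℝ) :
    1 - gaussE x = 2 * ∫ u in Set.Ioi x, Real.exp (-Real.pi * u ^ 2) := by
  have h := intervalIntegral.integral_Ioi_sub_Ioi' (a := (0 : ℝ)) (b := x)
    integrable_gauss.integrableOn integrable_gauss.integrableOn
  rw [integral_gauss_Ioi_zero] at h
  rw [gaussE, ← h]; ring

theorem gaussE_neg (x : ℝ) : gaussE (-x) = -gaussE x := by
  have h := intervalIntegral.integral_comp_neg (a := 0) (b := x)
    (fun u : ℝ => Real.exp (-Real.pi * u ^ 2))
  simp only [neg_sq, neg_zero] at h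
  rw [gaussE, intervalIntegral.integral_symm, ← h, gaussE]; ring

theorem gaussE_le_one (x : ℝ) : gaussE x ≤ 1 := by
  have h : 0 ≤ ∫ u in Set.Ioi x, Real.exp (-Real.pi * u ^ 2) :=
    integral_nonneg fun _ => (Real.exp_pos _).le
  linarith [one_sub_gaussE x]

theorem neg_one_le_gaussE (x : ℝ) : -1 ≤ gaussE x := by
  linarith [gaussE_le_one (-x), gaussE_neg x]

/-- Translate the tail integral to `u > 0` and use `(u + x)² ≥ u² + x²` there. -/
theorem one_sub_gaussE_le {x : ℝ} (hx : 0 ≤ x) : 1 - gaussE x ≤ Real.exp (-Real.pi * x ^ 2) := by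
  have hshift : ∫ u in Set.Ioi x, Real.exp (-Real.pi * u ^ 2) =
      ∫ u in Set.Ioi (0 : ℝ), Real.exp (-Real.pi * (u + x) ^ 2) := by
    have := (measurePreserving_add_right volume x).setIntegral_preimage_emb
      (measurableEmbedding_addRight x) (fun u : ℝ => Real.exp (-Real.pi * u ^ 2)) (Set.Ioi x)
    rw [← this]
    simp
  have hle : ∫ u in Set.Ioi (0 : ℝ), Real.exp (-Real.pi * (u + x) ^ 2) ≤
      ∫ u in Set.Ioi (0 : ℝ), Real.exp (-Real.pi * x ^ 2) * Real.exp (-Real.pi * u ^ 2) := by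
    refine setIntegral_mono_on (integrable_gauss.comp_add_right x).integrableOn
      (integrable_gauss.const_mul _).integrableOn measurableSet_Ioi fun u hu => ?_
    rw [← Real.exp_add]
    refine Real.exp_le_exp.2 ?_
    have hu' : 0 < u := hu
    nlinarith [Real.pi_pos, mul_nonneg hu'.le hx, mul_nonneg Real.pi_pos.le (mul_nonneg hu'.le hx)]
  rw [integral_const_mul, integral_gauss_Ioi_zero] at hle
  rw [one_sub_gaussE, hshift]; linarith

theorem tendsto_gaussE : Tendsto gaussE atTop (𝓝 1) := by
  have h := (intervalIntegral_tendsto_integral_Ioi 0 integrable_gauss.integrableOn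
    tendsto_id).const_mul 2
  rw [integral_gauss_Ioi_zero] at h
  rw [show (2 : ℝ) * (1 / 2) = 1 by norm_num] at h
  exact h

/-- By oddness `x + a > 0` may be assumed. If also `x + b ≥ 0`, the tail bound applies. Otherwise
`|x + b| < a - b`, so the product of the two exponentials is at least `1` and the trivial bound `2`
suffices; the constant is chosen for this case. -/
theorem abs_sign_sub_gaussE_le {κ : ℝ} (hκ : 0 ≤ κ) (a b x : ℝ) (hx : x + a ≠ 0) :
    |Real.sign (x + a) - gaussE ((x + b) * κ)| ≤
      2 * Real.exp (Real.pi * κ ^ 2 * (a - b) ^ 2) *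
        Real.exp (-Real.pi * ((x + b) * κ) ^ 2) := by
  wlog h : 0 < x + a generalizing x a b
  · have := this (-a) (-b) (-x) (by intro h0; apply hx; linarith)
      (by rcases lt_or_gt_of_ne hx with h1 | h1 <;> [linarith; exact absurd h1 h])
    rw [show -x + -a = -(x + a) by ring, show (-x + -b) * κ = -((x + b) * κ) by ring,
      Real.sign_neg, gaussE_neg, show -a - -b = -(a - b) by ring, neg_sq, neg_sq] at this
    rwa [← abs_neg, show -(Real.sign (x + a) - gaussE ((x + b) * κ)) =
      -Real.sign (x + a) - -gaussE ((x + b) * κ) by ring]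
  rw [Real.sign_of_pos h]
  have h1 := gaussE_le_one ((x + b) * κ)
  have h2 := neg_one_le_gaussE ((x + b) * κ)
  rw [abs_of_nonneg (by linarith)]
  have hpi := Real.pi_pos
  rcases le_or_gt 0 (x + b) with hb | hb
  · refine (one_sub_gaussE_le (mul_nonneg hb hκ)).trans ?_
    have : 1 ≤ 2 * Real.exp (Real.pi * κ ^ 2 * (a - b) ^ 2) := by
      have := Real.one_le_exp (x := Real.pi * κ ^ 2 * (a - b) ^ 2) (by positivity)
      linarith
    exact le_mul_of_one_le_left (Real.exp_pos _).le this
  · rw [mul_assoc, ← Real.exp_add]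
    have : 0 ≤ Real.pi * κ ^ 2 * (a - b) ^ 2 + -Real.pi * ((x + b) * κ) ^ 2 := by
      have h3 : 0 ≤ (a - b) ^ 2 - (x + b) ^ 2 := by nlinarith
      nlinarith [mul_nonneg (mul_nonneg hpi.le (sq_nonneg κ)) h3]
    have := Real.one_le_exp this
    linarith

/-! ### Gaussian cotangent sums and the completed geometric series -/

theorem integrableOn_gauss_shift {ρ : ℝ} (hρ : 0 < ρ) (k r : ℝ) :
    IntegrableOn (fun b : ℝ => Real.sqrt ρ * Real.exp (-Real.pi * ρ * (b - k) ^ 2)) (Set.Ioi r) := by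
  have h := (integrable_exp_neg_mul_sq (b := Real.pi * ρ) (by positivity)).comp_sub_right k
  simp only [← neg_mul] at h
  exact (h.const_mul _).integrableOn

theorem integral_gauss_shift {ρ : ℝ} (hρ : 0 < ρ) (k r : ℝ) :
    ∫ b in Set.Ioi r, Real.sqrt ρ * Real.exp (-Real.pi * ρ * (b - k) ^ 2) =
      (1 - gaussE ((r - k) * Real.sqrt ρ)) / 2 := by
  have hd : ∀ b : ℝ, HasDerivAt (fun b => gaussE ((b - k) * Real.sqrt ρ) / 2)
      (Real.sqrt ρ * Real.exp (-Real.pi * ρ * (b - k) ^ 2)) b := by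
    intro b
    have h1 : HasDerivAt (fun b : ℝ => (b - k) * Real.sqrt ρ) (1 * Real.sqrt ρ) b :=
      ((hasDerivAt_id b).sub_const k).mul_const _
    have := ((hasDerivAt_gaussE ((b - k) * Real.sqrt ρ)).comp b h1).div_const 2
    refine this.congr_deriv ?_
    rw [mul_pow, Real.sq_sqrt hρ.le]
    ring_nf
  have hlim : Tendsto (fun b => gaussE ((b - k) * Real.sqrt ρ) / 2) atTop (𝓝 (1 / 2)) := by
    refine (tendsto_gaussE.comp ?_).div_const 2
    exact (tendsto_atTop_add_const_right _ (-k) tendsto_id).atTop_mul_const (Real.sqrt_pos.2 hρ)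
  rw [integral_Ioi_of_hasDerivAt_of_tendsto' (fun b _ => hd b) (integrableOn_gauss_shift hρ k r) hlim]
  ring

/-- The Gaussian term of the Poisson summation formula. -/
def gaussTerm (ρ r : ℝ) (w : ℂ) (n : ℤ) : ℂ :=
  Complex.exp (-(Real.pi / ρ) * (w + n) ^ 2 + 2 * Real.pi * I * r * (w + n))

theorem norm_gaussTerm (ρ r : ℝ) (w : ℂ) (n : ℤ) :
    ‖gaussTerm ρ r w n‖ =
      Real.exp (-(Real.pi / ρ) * ((w.re + n) ^ 2 - w.im ^ 2)) * Real.exp (-(2 * Real.pi * w.im) * r) := by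
  rw [gaussTerm, Complex.norm_exp, ← Real.exp_add]
  congr 1
  have : (-(Real.pi / ρ) * (w + n) ^ 2 + 2 * Real.pi * I * r * (w + n) : ℂ) =
    ((-(Real.pi / ρ) : ℝ) : ℂ) * (w + n) ^ 2 + ((2 * Real.pi * r : ℝ) : ℂ) * ((w + n) * I) := by
    push_cast; ring
  rw [this, add_re, re_ofReal_mul, re_ofReal_mul, sq]
  simp
  ring

theorem summable_norm_gaussTerm {ρ : ℝ} (hρ : 0 < ρ) (r : ℝ) (w : ℂ) :
    Summable fun n : ℤ => ‖gaussTerm ρ r w n‖ := by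
  refine (summable_real_gaussian (div_pos Real.pi_pos hρ) (-(Real.pi / ρ) * (2 * w.re))
    (-(Real.pi / ρ) * (w.re ^ 2 - w.im ^ 2) + -(2 * Real.pi * w.im) * r)).congr fun n => ?_
  rw [norm_gaussTerm, ← Real.exp_add]
  congr 1; ring

/-- In `b` the term is a pure exponential of rate `2πi(w+n)`, decaying because `Im w > 0`. This
integration is where the poles `1/(w+n)` come from. -/
theorem integral_gaussTerm (ρ r : ℝ) {w : ℂ} (hw : 0 < w.im) (n : ℤ) :
    ∫ b in Set.Ioi r, gaussTerm ρ b w n =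
      -(gaussTerm ρ r w n / (2 * Real.pi * I * (w + n))) := by
  have ha : (2 * Real.pi * I * (w + n)).re < 0 := by
    have : (2 * Real.pi * I * (w + n) : ℂ) = ((2 * Real.pi : ℝ) : ℂ) * ((w + n) * I) := by
      push_cast; ring
    rw [this, re_ofReal_mul]
    have := mul_pos Real.two_pi_pos hw
    simp; linarith
  have h := integral_exp_mul_complex_Ioi ha r
  have e : ∀ b : ℝ, gaussTerm ρ b w n = Complex.exp (-(Real.pi / ρ) * (w + n) ^ 2) *
      Complex.exp (2 * Real.pi * I * (w + n) * b) := by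
    intro b
    rw [gaussTerm, ← Complex.exp_add]; congr 1; ring
  simp only [e]
  rw [integral_const_mul, h]
  ring

theorem integrableOn_norm_bound (A r : ℝ) {η : ℝ} (hη : 0 < η) :
    IntegrableOn (fun b : ℝ => A * Real.exp (-η * b)) (Set.Ioi r) ∧
      ∫ b in Set.Ioi r, A * Real.exp (-η * b) = A * (Real.exp (-η * r) / η) := by
  have h := integral_exp_mul_Ioi (a := -η) (by linarith) r
  refine ⟨(integrableOn_exp_mul_Ioi (a := -η) (by linarith) r).const_mul _, ?_⟩
  rw [integral_const_mul, h]
  ring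

theorem hasSum_integral_gaussTerm {ρ : ℝ} (hρ : 0 < ρ) (r : ℝ) {w : ℂ} (hw : 0 < w.im) :
    HasSum (fun n : ℤ => -(gaussTerm ρ r w n / (2 * Real.pi * I * (w + n))))
      (∫ b in Set.Ioi r, ∑' n : ℤ, gaussTerm ρ b w n) := by
  have hη : 0 < 2 * Real.pi * w.im := mul_pos Real.two_pi_pos hw
  have key := fun n : ℤ => integrableOn_norm_bound
    (Real.exp (-(Real.pi / ρ) * ((w.re + n) ^ 2 - w.im ^ 2))) r hη
  have h := hasSum_integral_of_summable_integral_norm (μ := volume.restrict (Set.Ioi r))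
    (F := fun (n : ℤ) (b : ℝ) => gaussTerm ρ b w n) (fun n => ?_) ?_
  · simpa only [integral_gaussTerm ρ r hw] using h
  · refine (integrable_norm_iff ?_).1 ?_
    · refine Continuous.aestronglyMeasurable ?_
      unfold gaussTerm; fun_prop
    · simp only [norm_gaussTerm]
      exact (key n).1
  · simp only [norm_gaussTerm, (key _).2]
    have := (summable_norm_gaussTerm hρ r w).div_const (2 * Real.pi * w.im)
    refine this.congr fun n => ?_
    rw [norm_gaussTerm]; ring

/-- The two ends converge for different reasons: for `k → +∞` the exponential decays and the
coefficient is bounded, for `k → -∞` the Gaussian decay of `1 - E` beats the growing exponential. -/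
theorem summable_one_sub_gaussE {ρ : ℝ} (hρ : 0 < ρ) (r : ℝ) {η : ℝ} (hη : 0 < η) :
    Summable fun k : ℤ => (1 - gaussE ((r - k) * Real.sqrt ρ)) / 2 * Real.exp (-η * k) := by
  have hE : ∀ x, 0 ≤ (1 - gaussE x) / 2 := fun x => by linarith [gaussE_le_one x]
  have hE' : ∀ x, (1 - gaussE x) / 2 ≤ 1 := fun x => by linarith [neg_one_le_gaussE x]
  refine Summable.of_nat_of_neg ?_ ?_
  · refine Summable.of_nonneg_of_le (fun n => mul_nonneg (hE _) (Real.exp_pos _).le)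
      (fun n => mul_le_of_le_one_left (Real.exp_pos _).le (hE' _)) ?_
    have := Real.summable_exp_nat_mul_iff.2 (show -η < 0 by linarith)
    refine this.congr fun n => ?_
    push_cast; ring_nf
  · have hs := (summable_real_gaussian (a := Real.pi * ρ) (by positivity) (2 * Real.pi * ρ * r - η)
      (-Real.pi * ρ * r ^ 2 + Real.pi * ρ * (1 / 2 - r) ^ 2)).comp_injective
        (neg_injective.comp Nat.cast_injective)
    refine Summable.of_nonneg_of_le (fun n => mul_nonneg (hE _) (Real.exp_pos _).le)
      (fun n => ?_) hs
    -- The offset `1/2` keeps the sign equal to `1` at `n = 0` too, while `n + r` may still be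
    -- negative for small `n`.
    have hn : (0 : ℝ) < (n : ℝ) + 1 / 2 := by positivity
    have h := abs_sign_sub_gaussE_le (Real.sqrt_nonneg ρ) (1 / 2) r n hn.ne'
    rw [Real.sign_of_pos hn] at h
    have h' := (le_abs_self _).trans h
    simp only [mul_pow, Real.sq_sqrt hρ.le] at h'
    have h2 : (1 - gaussE ((r - ((-(n : ℤ) : ℤ) : ℝ)) * Real.sqrt ρ)) / 2 ≤
        Real.exp (Real.pi * ρ * (1 / 2 - r) ^ 2) * Real.exp (-Real.pi * ((n + r) ^ 2 * ρ)) := by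
      push_cast
      rw [show r - -(n : ℝ) = n + r by ring]
      linarith
    refine (mul_le_mul_of_nonneg_right h2 (Real.exp_pos _).le).trans (le_of_eq ?_)
    simp only [← Real.exp_add, Function.comp]
    congr 1; push_cast; ring

theorem hasSum_integral_poisson {ρ : ℝ} (hρ : 0 < ρ) (r : ℝ) {w : ℂ} (hw : 0 < w.im) :
    HasSum (fun k : ℤ => (((1 - gaussE ((r - k) * Real.sqrt ρ)) / 2 : ℝ) : ℂ) * ex (k * w))
      (∫ b in Set.Ioi r, ∑' n : ℤ, gaussTerm ρ b w n) := by
  have hη : 0 < 2 * Real.pi * w.im := mul_pos Real.two_pi_pos hw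
  have h := hasSum_integral_of_summable_integral_norm (μ := volume.restrict (Set.Ioi r))
    (F := fun (k : ℤ) (b : ℝ) =>
      ((Real.sqrt ρ * Real.exp (-Real.pi * ρ * (b - k) ^ 2) : ℝ) : ℂ) * ex (k * w)) (fun k => ?_) ?_
  · have h1 : ∀ b : ℝ, ∑' k : ℤ,
        ((Real.sqrt ρ * Real.exp (-Real.pi * ρ * (b - k) ^ 2) : ℝ) : ℂ) * ex (k * w) =
        ∑' n : ℤ, gaussTerm ρ b w n := by
      intro b
      unfold gaussTerm
      rw [tsum_gaussian_poisson hρ, ← tsum_mul_left]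
      refine tsum_congr fun k => ?_
      rw [Complex.ofReal_mul, mul_assoc]
    simp only [integral_mul_const, h1, integral_complex_ofReal, integral_gauss_shift hρ] at h
    exact h
  · exact ((integrableOn_gauss_shift hρ k r).ofReal).mul_const _
  · have hn : ∀ (k : ℤ) (b : ℝ),
        ‖((Real.sqrt ρ * Real.exp (-Real.pi * ρ * (b - k) ^ 2) : ℝ) : ℂ) * ex (k * w)‖ =
        (Real.sqrt ρ * Real.exp (-Real.pi * ρ * (b - k) ^ 2)) *
          Real.exp (-(2 * Real.pi * w.im) * k) := by
      intro k b
      rw [norm_mul, norm_ex, Complex.norm_of_nonneg (by positivity)]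
      congr 2
      simp; ring
    simp only [hn, integral_mul_const, integral_gauss_shift hρ]
    exact summable_one_sub_gaussE hρ r hη

/-- The coefficient `sgn - E` of the completed geometric series. -/
def gapCoeff (ρ r : ℝ) (s k : ℤ) : ℝ :=
  Real.sign (-(k : ℝ) - s - 1 / 2) - gaussE ((r - k) * Real.sqrt ρ)

-- The argument of the sign is a half-integer, so it never vanishes and the comparison of `sgn` with
-- `E` applies for every `k`.
theorem abs_gapCoeff_le {ρ : ℝ} (hρ : 0 < ρ) (r : ℝ) (s k : ℤ) :
    |gapCoeff ρ r s k| ≤ 2 * Real.exp (Real.pi * ρ * (-s - 1 / 2 - r) ^ 2) *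
      Real.exp (-Real.pi * ρ * (r - k) ^ 2) := by
  have hne : (-(k : ℝ)) + (-s - 1 / 2) ≠ 0 := by
    intro h
    have h2 : ((2 * (k + s) + 1 : ℤ) : ℝ) = 0 := by push_cast; linarith
    have h3 : (2 * (k + s) + 1 : ℤ) = 0 := by exact_mod_cast h2
    omega
  have h := abs_sign_sub_gaussE_le (Real.sqrt_nonneg ρ) (-s - 1 / 2) r (-(k : ℝ)) hne
  rw [mul_pow, Real.sq_sqrt hρ.le] at h
  rw [gapCoeff]
  rw [show -(k : ℝ) - s - 1 / 2 = -(k : ℝ) + (-s - 1 / 2) by ring,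
    show (r - k) * Real.sqrt ρ = (-(k : ℝ) + r) * Real.sqrt ρ by ring,
    show -Real.pi * ρ * (r - k) ^ 2 = -Real.pi * ((-(k : ℝ) + r) ^ 2 * ρ) by ring]
  exact h

theorem summable_gapCoeff_mul_exp {ρ : ℝ} (hρ : 0 < ρ) (r : ℝ) (s : ℤ) (b : ℝ) :
    Summable fun k : ℤ => |gapCoeff ρ r s k| * Real.exp (b * k) := by
  refine Summable.of_nonneg_of_le (fun k => by positivity)
    (fun k => mul_le_mul_of_nonneg_right (abs_gapCoeff_le hρ r s k) (Real.exp_pos _).le) ?_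
  have hs := (summable_real_gaussian (a := Real.pi * ρ) (by positivity)
    (2 * Real.pi * ρ * r + b) (-Real.pi * ρ * r ^ 2)).mul_left
    (2 * Real.exp (Real.pi * ρ * (-s - 1 / 2 - r) ^ 2))
  refine hs.congr fun k => ?_
  rw [mul_assoc (2 * Real.exp _) (Real.exp _) (Real.exp _), ← Real.exp_add]
  congr 2; ring

theorem norm_ex_int_mul (k : ℤ) (w : ℂ) : ‖ex (k * w)‖ = Real.exp (-(2 * Real.pi * w.im) * k) := by
  rw [norm_ex]; congr 1; simp; ring

theorem summable_gapCoeff_mul_ex {ρ : ℝ} (hρ : 0 < ρ) (r : ℝ) (s : ℤ) (w : ℂ) :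
    Summable fun k : ℤ => (gapCoeff ρ r s k : ℂ) * ex (k * w) := by
  refine Summable.of_norm ?_
  refine (summable_gapCoeff_mul_exp hρ r s (-(2 * Real.pi * w.im))).congr fun k => ?_
  rw [norm_mul, norm_ex_int_mul, Complex.norm_real, Real.norm_eq_abs]

theorem one_sub_ex_ne_zero {w : ℂ} (hw : ∀ n : ℤ, w ≠ n) : 1 - ex w ≠ 0 := by
  intro h
  obtain ⟨n, hn⟩ := (ex_eq_one_iff w).1 (sub_eq_zero.1 h).symm
  exact hw n hn

theorem sign_gap_of_le {s k : ℤ} (h : -s ≤ k) : Real.sign (-(k : ℝ) - s - 1 / 2) = -1 := by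
  have : (-s : ℝ) ≤ k := by exact_mod_cast h
  exact Real.sign_of_neg (by linarith)

theorem sign_gap_of_lt {s k : ℤ} (h : k < -s) : Real.sign (-(k : ℝ) - s - 1 / 2) = 1 := by
  have : (k : ℝ) + 1 ≤ -s := by exact_mod_cast h
  exact Real.sign_of_pos (by linarith)

/-- The geometric series as a sum over all integers, `|ex w| < 1`. -/
theorem hasSum_ex_geometric (s : ℤ) {w : ℂ} (hw : 0 < w.im) :
    HasSum (fun k : ℤ => (((1 - Real.sign (-(k : ℝ) - s - 1 / 2)) / 2 : ℝ) : ℂ) * ex (k * w))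
      (ex (-s * w) / (1 - ex w)) := by
  -- The coefficient `(1 - sgn)/2` is the indicator of `k ≥ -s`, the image of `ℕ` under this map.
  have hinj : Function.Injective fun n : ℕ => (n : ℤ) - s := fun a b h => by
    simpa using h
  refine (hinj.hasSum_iff ?_).1 ?_
  · intro k hk
    have hlt : k < -s := by
      by_contra hc
      refine hk ⟨(k + s).toNat, ?_⟩
      have : ((k + s).toNat : ℤ) = k + s := Int.toNat_of_nonneg (by omega)
      simp only [this]; ring
    rw [sign_gap_of_lt hlt]; simp
  · have hn : ‖ex w‖ < 1 := by
      rw [norm_ex, Real.exp_lt_one_iff]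
      have := mul_pos Real.two_pi_pos hw
      linarith
    have h := (hasSum_geometric_of_norm_lt_one hn).mul_left (ex (-s * w))
    rw [← div_eq_mul_inv] at h
    refine h.congr_fun fun n => ?_
    simp only [Function.comp]
    rw [sign_gap_of_le (by omega), ← ex_nat_mul, ← ex_add]
    norm_num
    congr 1; ring

/-- The geometric series `∑_{k ≥ -s} ex (k w)`, continued to all `w`, completed by the error function
series. -/
def completedGeom (ρ r : ℝ) (s : ℤ) (w : ℂ) : ℂ :=
  ex (-s * w) / (1 - ex w) + 1 / 2 * ∑' k : ℤ, (gapCoeff ρ r s k : ℂ) * ex (k * w)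

theorem tsum_gaussTerm_div_eq_gaussE {ρ : ℝ} (hρ : 0 < ρ) (r : ℝ) {w : ℂ} (hw : 0 < w.im) :
    ∑' n : ℤ, gaussTerm ρ r w n / (w + n) = -(2 * Real.pi * I) *
      ∑' k : ℤ, (((1 - gaussE ((r - k) * Real.sqrt ρ)) / 2 : ℝ) : ℂ) * ex (k * w) := by
  have h1 := (hasSum_integral_gaussTerm hρ r hw).tsum_eq
  rw [← (hasSum_integral_poisson hρ r hw).tsum_eq] at h1
  rw [← h1, ← tsum_mul_left]
  refine tsum_congr fun n => ?_
  have := Complex.two_pi_I_ne_zero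
  have hwn : w + n ≠ 0 := by
    intro h
    have := congrArg Complex.im h
    simp at this; linarith
  field_simp

/-- Split `1 - E` as `(1 - sgn) + (sgn - E)`. The first part is a geometric series with a closed
form meaningful for all nonintegral `w`; the second has Gaussian decay and converges for every `w`.
The value of `s` only decides where the split is made. -/
theorem tsum_gaussTerm_div_of_im_pos {ρ : ℝ} (hρ : 0 < ρ) (r : ℝ) (s : ℤ) {w : ℂ} (hw : 0 < w.im) :
    ∑' n : ℤ, gaussTerm ρ r w n / (w + n) = -(2 * Real.pi * I) * completedGeom ρ r s w := by
  rw [tsum_gaussTerm_div_eq_gaussE hρ r hw, completedGeom, ← (hasSum_ex_geometric s hw).tsum_eq,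
    ← tsum_mul_left (a := (1 / 2 : ℂ)), ← ((hasSum_ex_geometric s hw).summable).tsum_add
      ((summable_gapCoeff_mul_ex hρ r s w).mul_left _)]
  congr 1
  refine tsum_congr fun k => ?_
  rw [gapCoeff]; push_cast; ring

theorem gaussTerm_neg (ρ r : ℝ) (w : ℂ) (n : ℤ) :
    gaussTerm ρ (-r) (-w) (-n) = gaussTerm ρ r w n := by
  unfold gaussTerm; congr 1; push_cast; ring

/-- Replacing `s` by `-s - 1` negates the threshold `-s - 1/2`, so together with `k ↦ -k` every
coefficient changes sign. This carries the completion formula to the lower half plane. -/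
theorem completedGeom_neg (ρ r : ℝ) (s : ℤ) {w : ℂ} (hw : ∀ n : ℤ, w ≠ n) :
    completedGeom ρ (-r) (-s - 1) (-w) = -completedGeom ρ r s w := by
  have h1 : ∑' k : ℤ, (gapCoeff ρ (-r) (-s - 1) k : ℂ) * ex (k * -w) =
      - ∑' k : ℤ, (gapCoeff ρ r s k : ℂ) * ex (k * w) := by
    rw [← tsum_neg, ← (Equiv.neg ℤ).tsum_eq]
    refine tsum_congr fun k => ?_
    simp only [Equiv.neg_apply, gapCoeff]
    push_cast
    rw [show (-r - -(k : ℝ)) * Real.sqrt ρ = -((r - k) * Real.sqrt ρ) by ring, gaussE_neg,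
      show - -(k : ℝ) - (-s - 1) - 1 / 2 = -(-(k : ℝ) - s - 1 / 2) by ring, Real.sign_neg]
    push_cast
    ring_nf
  have h2 : ex (-((-s - 1 : ℤ) : ℂ) * -w) / (1 - ex (-w)) = -(ex (-s * w) / (1 - ex w)) := by
    have h3 := one_sub_ex_ne_zero hw
    have h4 := ex_ne_zero w
    have h5 : 1 - (ex w)⁻¹ = -(1 - ex w) / ex w := by
      field_simp
      ring
    rw [show -((-s - 1 : ℤ) : ℂ) * -w = -s * w - w by push_cast; ring, ex_sub, ex_neg, h5]
    field_simp
  rw [completedGeom, completedGeom, h1, h2]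
  ring

theorem tsum_gaussTerm_div_of_im_ne_zero {ρ : ℝ} (hρ : 0 < ρ) (r : ℝ) (s : ℤ) {w : ℂ}
    (hw : w.im ≠ 0) :
    ∑' n : ℤ, gaussTerm ρ r w n / (w + n) = -(2 * Real.pi * I) * completedGeom ρ r s w := by
  rcases lt_or_gt_of_ne hw with h | h
  · have hint : ∀ n : ℤ, w ≠ n := by rintro n rfl; simp at h
    have h1 := tsum_gaussTerm_div_of_im_pos hρ (-r) (-s - 1) (w := -w) (by simpa using h)
    rw [completedGeom_neg ρ r s hint, ← (Equiv.neg ℤ).tsum_eq] at h1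
    simp only [Equiv.neg_apply, gaussTerm_neg] at h1
    have h2 : ∑' n : ℤ, gaussTerm ρ r w n / (-w + ((-n : ℤ) : ℂ)) =
        -∑' n : ℤ, gaussTerm ρ r w n / (w + n) := by
      rw [← tsum_neg]
      refine tsum_congr fun n => ?_
      rw [show -w + ((-n : ℤ) : ℂ) = -(w + n) by push_cast; ring, div_neg]
    rw [h2] at h1
    linear_combination -h1
  · exact tsum_gaussTerm_div_of_im_pos hρ r s h

theorem tendsto_completedGeom {ρ : ℝ} (hρ : 0 < ρ) (r : ℝ) (s : ℤ) {x : ℝ} (hx : ∀ n : ℤ, x ≠ n) :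
    Tendsto (fun η : ℝ => completedGeom ρ r s (x + η * I)) (𝓝[>] 0)
      (𝓝 (completedGeom ρ r s x)) := by
  have hpath : Continuous fun η : ℝ => (x : ℂ) + η * I := by fun_prop
  have hpath0 : (x : ℂ) + (0 : ℝ) * I = x := by simp
  have hc : ∀ a : ℂ, Tendsto (fun η : ℝ => ex (a * (x + η * I))) (𝓝[>] 0) (𝓝 (ex (a * x))) := by
    intro a
    have : Continuous fun η : ℝ => ex (a * ((x : ℂ) + η * I)) :=
      continuous_ex.comp (continuous_const.mul hpath)
    have h := this.tendsto 0
    rw [hpath0] at h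
    exact h.mono_left nhdsWithin_le_nhds
  have hxc : ∀ n : ℤ, (x : ℂ) ≠ n := fun n h => hx n (by exact_mod_cast h)
  refine Tendsto.add (Tendsto.div (hc _) (tendsto_const_nhds.sub (by simpa using hc 1))
    (one_sub_ex_ne_zero hxc)) (Tendsto.const_mul _ ?_)
  refine tendsto_tsum_of_dominated_convergence
    -- For `0 < η ≤ 1` the factor `exp(-2πηk)` is at most `1` if `k ≥ 0` and at most `exp(-2πk)` if
    -- `k < 0`; the sum of both majorizes it in either case.
    (bound := fun k : ℤ => |gapCoeff ρ r s k| * Real.exp (-(2 * Real.pi) * k) +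
      |gapCoeff ρ r s k| * Real.exp (0 * k))
    ((summable_gapCoeff_mul_exp hρ r s _).add (summable_gapCoeff_mul_exp hρ r s _))
    (fun k => (hc k).const_mul _) ?_
  filter_upwards [Ioc_mem_nhdsGT (zero_lt_one' ℝ)] with η hη k
  rw [norm_mul, norm_ex_int_mul, Complex.norm_real, Real.norm_eq_abs, ← mul_add]
  refine mul_le_mul_of_nonneg_left ?_ (abs_nonneg _)
  have him : ((x : ℂ) + η * I).im = η := by simp
  rw [him, zero_mul, Real.exp_zero]
  have hpi := Real.two_pi_pos
  rcases le_or_gt 0 (k : ℝ) with hk | hk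
  · have : Real.exp (-(2 * Real.pi * η) * k) ≤ 1 := by
      rw [Real.exp_le_one_iff]
      have := mul_nonneg (mul_nonneg hpi.le hη.1.le) hk
      linarith
    linarith [Real.exp_pos (-(2 * Real.pi) * k)]
  · have : Real.exp (-(2 * Real.pi * η) * k) ≤ Real.exp (-(2 * Real.pi) * k) := by
      refine Real.exp_le_exp.2 ?_
      have : 0 ≤ (1 - η) * (2 * Real.pi * (-k)) :=
        mul_nonneg (by linarith [hη.2]) (mul_nonneg hpi.le (by linarith))
      linarith
    linarith

theorem tendsto_tsum_gaussTerm_div {ρ : ℝ} (hρ : 0 < ρ) (r : ℝ) {x : ℝ} (hx : ∀ n : ℤ, x ≠ n) :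
    Tendsto (fun η : ℝ => ∑' n : ℤ, gaussTerm ρ r (x + η * I) n / (x + η * I + n)) (𝓝[>] 0)
      (𝓝 (∑' n : ℤ, gaussTerm ρ r x n / (x + n))) := by
  -- The distance from `x` to the nearest integer bounds all denominators from below, uniformly in
  -- `η` and `n`.
  set δ := |x - round x| with hδ
  have hδ0 : 0 < δ := abs_pos.2 (sub_ne_zero.2 (hx _))
  have hδn : ∀ n : ℤ, δ ≤ |x + n| := fun n => by
    have := round_le x (-n)
    rwa [Int.cast_neg, sub_neg_eq_add] at this
  refine tendsto_tsum_of_dominated_convergence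
    (bound := fun n : ℤ => ‖gaussTerm ρ 0 x n‖ * (Real.exp (Real.pi / ρ + 2 * Real.pi * |r|) / δ))
    ((summable_norm_gaussTerm hρ 0 x).mul_right _) ?_ ?_
  · intro n
    have hc : ContinuousAt (fun η : ℝ => gaussTerm ρ r (x + η * I) n / (x + η * I + n)) 0 := by
      refine ContinuousAt.div ?_ (by fun_prop) ?_
      · unfold gaussTerm; fun_prop
      · have : (x : ℂ) + n ≠ 0 := by
          intro h
          apply hx (-n)
          have : (x : ℂ) = ((-n : ℤ) : ℝ) := by push_cast; linear_combination h
          exact_mod_cast this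
        simpa using this
    have := hc.tendsto
    simp only [ofReal_zero, zero_mul, add_zero] at this
    exact this.mono_left nhdsWithin_le_nhds
  · filter_upwards [Ioc_mem_nhdsGT (zero_lt_one' ℝ)] with η hη n
    have hre : ((x : ℂ) + η * I).re = x := by simp
    have him : ((x : ℂ) + η * I).im = η := by simp
    have hden : δ ≤ ‖(x : ℂ) + η * I + n‖ := by
      refine (hδn n).trans ?_
      have := Complex.abs_re_le_norm ((x : ℂ) + η * I + n)
      simpa using this
    rw [norm_div, mul_div_assoc']
    refine div_le_div₀ (by positivity) ?_ hδ0 hden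
    rw [norm_gaussTerm, norm_gaussTerm, hre, him, ← Real.exp_add, ← Real.exp_add, ← Real.exp_add]
    refine Real.exp_le_exp.2 ?_
    have hpr : 0 < Real.pi / ρ := div_pos Real.pi_pos hρ
    have h1 : Real.pi / ρ * η ^ 2 ≤ Real.pi / ρ := by
      have : η ^ 2 ≤ 1 := by nlinarith [hη.1, hη.2]
      nlinarith
    have h2 : -(η * r) ≤ |r| := by
      have : |η * r| ≤ 1 * |r| := by
        rw [abs_mul, abs_of_pos hη.1]
        exact mul_le_mul_of_nonneg_right hη.2 (abs_nonneg _)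
      linarith [neg_abs_le (η * r)]
    have h3 := mul_le_mul_of_nonneg_left h2 Real.two_pi_pos.le
    simp only [ofReal_re, ofReal_im]
    nlinarith

/-- Completion formula: a Gaussian-weighted cotangent sum is a geometric series plus an error
function series. -/
theorem tsum_gaussTerm_div {ρ : ℝ} (hρ : 0 < ρ) (r : ℝ) (s : ℤ) {w : ℂ} (hw : ∀ n : ℤ, w ≠ n) :
    ∑' n : ℤ, gaussTerm ρ r w n / (w + n) = -(2 * Real.pi * I) * completedGeom ρ r s w := by
  by_cases him : w.im = 0
  · obtain ⟨x, rfl⟩ : ∃ x : ℝ, w = x := ⟨w.re, by apply Complex.ext <;> simp [him]⟩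
    have hx : ∀ n : ℤ, x ≠ n := fun n h => hw n (by exact_mod_cast congrArg Complex.ofReal h)
    refine tendsto_nhds_unique (tendsto_tsum_gaussTerm_div hρ r hx)
      (((tendsto_completedGeom hρ r s hx).const_mul _).congr' ?_)
    filter_upwards [self_mem_nhdsWithin] with η hη
    refine (tsum_gaussTerm_div_of_im_ne_zero hρ r s ?_).symm
    have : 0 < η := hη
    simpa using this.ne'
  · exact tsum_gaussTerm_div_of_im_ne_zero hρ r s him

/-! ### Real coordinates and Gaussian lattice sums -/

/-- The coordinate `r` in `z = p + r τ`. -/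
def cr (τ z : ℂ) : ℝ := z.im / τ.im

/-- The coordinate `p` in `z = p + r τ`. -/
def cp (τ z : ℂ) : ℝ := z.re - z.im / τ.im * τ.re

theorem coord_eq {τ : ℂ} (hτ : 0 < τ.im) (z : ℂ) : z = cp τ z + cr τ z * τ := by
  have := hτ.ne'
  apply Complex.ext
  · simp [cp, cr]
  · simp [cr]; field_simp

theorem cr_eq {τ : ℂ} (hτ : 0 < τ.im) {z : ℂ} {p r : ℝ} (h : z = p + r * τ) : cr τ z = r := by
  have := hτ.ne'
  rw [cr, h]; simp; field_simp

theorem cp_eq {τ : ℂ} (hτ : 0 < τ.im) {z : ℂ} {p r : ℝ} (h : z = p + r * τ) : cp τ z = p := by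
  have h1 := cr_eq hτ h
  rw [cr] at h1
  rw [cp, h1, h]; simp

theorem normSq_lattice_ge {τ : ℂ} (hτ : 0 < τ.im) :
    ∃ δ : ℝ, 0 < δ ∧ ∀ a b : ℝ, δ * (a ^ 2 + b ^ 2) ≤ ‖(a : ℂ) * τ + b‖ ^ 2 := by
  have hy : 0 < τ.im ^ 2 := by positivity
  have hK : 0 < 2 + (1 + 2 * τ.re ^ 2) / τ.im ^ 2 := by positivity
  -- With `N = ‖aτ + b‖²` one has `a² ≤ N/(Im τ)²` and `b² ≤ 2(a Re τ + b)² + 2a²(Re τ)²`; adding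
  -- the two gives this constant.
  refine ⟨(2 + (1 + 2 * τ.re ^ 2) / τ.im ^ 2)⁻¹, inv_pos.2 hK, fun a b => ?_⟩
  rw [inv_mul_le_iff₀ hK]
  have h1 : ‖(a : ℂ) * τ + b‖ ^ 2 = (a * τ.re + b) ^ 2 + a ^ 2 * τ.im ^ 2 := by
    rw [← Complex.normSq_eq_norm_sq, Complex.normSq_apply]
    simp; ring
  rw [h1]
  have h2 : (1 + 2 * τ.re ^ 2) / τ.im ^ 2 * (a ^ 2 * τ.im ^ 2) = (1 + 2 * τ.re ^ 2) * a ^ 2 := by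
    field_simp
  have h3 : 0 ≤ (1 + 2 * τ.re ^ 2) / τ.im ^ 2 * (a * τ.re + b) ^ 2 := by positivity
  nlinarith [sq_nonneg (2 * a * τ.re + b), sq_nonneg (a * τ.im)]

theorem summable_lattice_gaussian {c : ℝ} (hc : 0 < c) {τ : ℂ} (hτ : 0 < τ.im) (z : ℂ) :
    Summable fun p : ℤ × ℤ => Real.exp (-c * ‖z + p.1 * τ + p.2‖ ^ 2) := by
  obtain ⟨δ, hδ, hle⟩ := normSq_lattice_ge hτ
  have hg : ∀ t : ℝ, Summable fun n : ℤ => Real.exp (-(c * δ) * (n + t) ^ 2) := fun t => by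
    refine (summable_real_gaussian (mul_pos hc hδ) (-(c * δ) * (2 * t))
      (-(c * δ) * t ^ 2)).congr fun n => ?_
    congr 1; ring
  refine Summable.of_nonneg_of_le (fun _ => (Real.exp_pos _).le) (fun p => ?_)
    ((hg (cr τ z)).mul_of_nonneg (hg (cp τ z)) (fun _ => (Real.exp_pos _).le)
      (fun _ => (Real.exp_pos _).le))
  rw [← Real.exp_add]
  refine Real.exp_le_exp.2 ?_
  have h := hle (p.1 + cr τ z) (p.2 + cp τ z)
  have e : ((p.1 + cr τ z : ℝ) : ℂ) * τ + ((p.2 + cp τ z : ℝ) : ℂ) = z + p.1 * τ + p.2 := by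
    push_cast
    linear_combination -coord_eq hτ z
  rw [e] at h
  nlinarith

theorem summable_lattice_gaussian_div {c : ℝ} (hc : 0 < c) {τ : ℂ} (hτ : 0 < τ.im) (z : ℂ) :
    Summable fun p : ℤ × ℤ =>
      Real.exp (-c * ‖z + p.1 * τ + p.2‖ ^ 2) / ‖z + p.1 * τ + p.2‖ := by
  have hs := summable_lattice_gaussian hc hτ z
  refine Summable.of_norm_bounded_eventually hs ?_
  -- A Gaussian value below `exp(-c)` forces the norm above `1`, so for all but finitely many
  -- lattice points the division only shrinks the term.
  have := hs.tendsto_cofinite_zero.eventually (gt_mem_nhds (Real.exp_pos (-c)))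
  filter_upwards [this] with p hp
  have h1 : 1 ≤ ‖z + p.1 * τ + p.2‖ := by
    have h2 := Real.exp_lt_exp.1 hp
    by_contra h
    push Not at h
    have : ‖z + p.1 * τ + p.2‖ ^ 2 < 1 := by
      have := norm_nonneg (z + p.1 * τ + p.2)
      nlinarith
    nlinarith
  rw [Real.norm_of_nonneg (by positivity)]
  exact div_le_self (Real.exp_pos _).le h1

/-- The summand of the Gaussian-regularized Kronecker–Eisenstein series of weight one. -/
def latTerm (κ : ℝ) (τ z₁ z₂ : ℂ) (α ν : ℝ) : ℂ :=
  Complex.exp (-(Real.pi * κ / τ.im * ‖z₁ + α * τ + ν‖ ^ 2 : ℝ)) *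
    ex (κ * (α * cp τ z₂ - ν * cr τ z₂)) / (z₁ + α * τ + ν)

theorem norm_ex_ofReal (x : ℝ) : ‖ex x‖ = 1 := by
  rw [norm_ex]; simp

theorem norm_latTerm (κ : ℝ) (τ z₁ z₂ : ℂ) (α ν : ℝ) :
    ‖latTerm κ τ z₁ z₂ α ν‖ = Real.exp (-(Real.pi * κ / τ.im) * ‖z₁ + α * τ + ν‖ ^ 2) /
      ‖z₁ + α * τ + ν‖ := by
  rw [latTerm, norm_div, norm_mul,
    show (κ : ℂ) * (α * cp τ z₂ - ν * cr τ z₂) = ((κ * (α * cp τ z₂ - ν * cr τ z₂) : ℝ) : ℂ) by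
      push_cast; ring, norm_ex_ofReal, mul_one, ← Complex.ofReal_neg, ← Complex.ofReal_exp,
    Complex.norm_of_nonneg (Real.exp_pos _).le, neg_mul]

theorem summable_norm_latTerm {κ : ℝ} (hκ : 0 < κ) {τ : ℂ} (hτ : 0 < τ.im) (z₁ z₂ : ℂ) :
    Summable fun p : ℤ × ℤ => ‖latTerm κ τ z₁ z₂ p.1 p.2‖ := by
  refine (summable_lattice_gaussian_div (c := Real.pi * κ / τ.im)
    (div_pos (mul_pos Real.pi_pos hκ) hτ) hτ z₁).congr fun p => ?_
  rw [norm_latTerm]; simp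

theorem ofReal_norm_sq (w : ℂ) : ((‖w‖ ^ 2 : ℝ) : ℂ) = w * (starRingEnd ℂ) w := by
  rw [Complex.mul_conj, Complex.normSq_eq_norm_sq]

theorem conj_eq_sub (τ : ℂ) : (starRingEnd ℂ) τ = τ - 2 * τ.im * I := by
  apply Complex.ext
  · simp
  · simp; ring

/-- The lattice sum, split along the powers of `q`, consists of the completed geometric terms. -/
theorem gaussTerm_eq_latTerm (N : ℕ) {τ : ℂ} (hτ : 0 < τ.im) (z₁ z₂ : ℂ) (j n : ℤ) (hN : 0 < N) :
    ex (N * j * (z₁ + z₂) + N * j ^ 2 * τ) *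
        (gaussTerm (τ.im / N) (N * (z₁ - z₂).im / τ.im) (z₁ + j * τ) n / (z₁ + j * τ + n)) =
      ex (-N * z₁ * cr τ z₂) * latTerm N τ z₁ z₂ j n := by
  have hy : (τ.im : ℂ) ≠ 0 := by exact_mod_cast hτ.ne'
  have hN' : (N : ℂ) ≠ 0 := by exact_mod_cast hN.ne'
  have hr : ((N * (z₁ - z₂).im / τ.im : ℝ) : ℂ) = N * (cr τ z₁ - cr τ z₂) := by
    simp only [cr, Complex.sub_im]; push_cast; field_simp
  rw [latTerm, gaussTerm, hr, mul_div_assoc', mul_div_assoc']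
  simp only [Complex.ofReal_intCast]
  congr 1
  have hc : (starRingEnd ℂ) (z₁ + j * τ + n) =
      cp τ z₁ + n + (cr τ z₁ + j) * (τ - 2 * τ.im * I) := by
    conv_lhs => rw [coord_eq hτ z₁]
    simp only [map_add, map_mul, Complex.conj_ofReal, map_intCast]
    rw [conj_eq_sub τ]
    ring
  -- The two exponents agree only modulo `2πi`; the integer `Njn` is the discrepancy. The rest is
  -- `|W|² = W² - 2i(Im W)W` for `W = z₁ + jτ + n`.
  rw [← ex_add_int (N * j * (z₁ + z₂) + N * j ^ 2 * τ) (N * j * n : ℤ)]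
  rw [Complex.ofReal_mul _ (‖_‖ ^ 2), ofReal_norm_sq, hc]
  have h1 := coord_eq hτ z₁
  have h2 := coord_eq hτ z₂
  generalize cp τ z₁ = p₁ at *
  generalize cr τ z₁ = r₁ at *
  generalize cp τ z₂ = p₂ at *
  generalize cr τ z₂ = r₂ at *
  simp only [ex]
  rw [← Complex.exp_add, ← Complex.exp_add, ← Complex.exp_add]
  congr 1
  rw [h1, h2]
  push_cast
  field_simp
  ring

/-! ### The correction term as a double series; the modified numerator as a lattice sum -/

/-- The term of the theta series. -/
def thetaTerm (j : ℤ) (n : ℕ) (τ z : ℂ) (k : ℤ) : ℂ :=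
  ex ((n : ℂ) * z * ((k : ℂ) + (j : ℂ) / (2 * (n : ℂ)))
    + (n : ℂ) * ((k : ℂ) + (j : ℂ) / (2 * (n : ℂ))) ^ 2 * τ)

theorem summable_norm_thetaTerm (j : ℤ) {n : ℕ} (hn : 0 < n) {τ : ℂ} (hτ : 0 < τ.im) (z : ℂ) :
    Summable fun k : ℤ => ‖thetaTerm j n τ z k‖ := by
  have hn' : (0 : ℝ) < n := by exact_mod_cast hn
  set c : ℝ := j / (2 * n) with hc
  refine (summable_real_gaussian (a := 2 * Real.pi * (n * τ.im)) (by positivity)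
    (-(2 * Real.pi) * (n * z.im + 2 * (n * τ.im) * c))
    (-(2 * Real.pi) * (n * z.im * c + n * τ.im * c ^ 2))).congr fun k => ?_
  rw [thetaTerm, norm_ex]
  have e : (n : ℂ) * z * ((k : ℂ) + (j : ℂ) / (2 * (n : ℂ)))
    + (n : ℂ) * ((k : ℂ) + (j : ℂ) / (2 * (n : ℂ))) ^ 2 * τ =
      ((n * (k + c) : ℝ) : ℂ) * z + ((n * (k + c) ^ 2 : ℝ) : ℂ) * τ := by
    rw [hc]; push_cast; ring
  rw [e, Complex.add_im, Complex.im_ofReal_mul, Complex.im_ofReal_mul]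
  congr 1; ring

/-- The term of the double series that completes `Φ₁`. -/
def errTerm (m s : ℕ) (τ z₁ z₂ : ℂ) (p : ℤ × ℤ) : ℂ :=
  ex (((m : ℂ) + 1) * p.1 * (z₁ + z₂) + ((m : ℂ) + 1) * p.1 ^ 2 * τ) *
    ((gapCoeff (τ.im / (m + 1)) ((m + 1) * (z₁ - z₂).im / τ.im) s p.2 : ℂ) *
      ex (p.2 * (z₁ + p.1 * τ)))

/-- For `J` in this window of length `2(m+1)` starting at `-s`, both signs depend on `l` alone:
positive for `l ≥ 1`, negative for `l ≤ 0`. This is why the sum over `j` in the correction starts at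
`-s`. -/
theorem zwegersTerm_eq (m s : ℕ) {J : ℤ}
    (hJ : J ∈ Finset.Icc (-(s : ℤ)) (-(s : ℤ) + 2 * (m : ℤ) + 1)) (τ z₁ z₂ : ℂ) (l : ℤ) :
    zwegersTerm m J τ ((z₁ - z₂) / 2) (2 * ((m : ℤ) + 1) * l - J) =
      (gapCoeff (τ.im / (m + 1)) ((m + 1) * (z₁ - z₂).im / τ.im) s (J - 2 * ((m : ℤ) + 1) * l) : ℂ) *
      Complex.exp (-((Real.pi : ℂ) * I * ((2 * ((m : ℤ) + 1) * l - J : ℤ) : ℂ) ^ 2 /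
        (2 * ((m : ℂ) + 1))) * τ
        - 2 * (Real.pi : ℂ) * I * ((2 * ((m : ℤ) + 1) * l - J : ℤ) : ℂ) * ((z₁ - z₂) / 2)) := by
  rw [Finset.mem_Icc] at hJ
  rw [zwegersTerm, gapCoeff]
  have him : ((z₁ - z₂) / 2).im = (z₁ - z₂).im / 2 := by
    rw [show (z₁ - z₂) / 2 = (((1 / 2 : ℝ)) : ℂ) * (z₁ - z₂) by push_cast; ring, im_ofReal_mul]
    ring
  have hm : (0 : ℝ) ≤ m := Nat.cast_nonneg m
  have hsign : Real.sign (((2 * ((m : ℤ) + 1) * l - J : ℤ) : ℝ) + 1 / 2 + (J : ℝ)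
      - 2 * ((m : ℝ) + 1)) =
      Real.sign (-((J - 2 * ((m : ℤ) + 1) * l : ℤ) : ℝ) - ((s : ℤ) : ℝ) - 1 / 2) := by
    rcases le_or_gt l 0 with hl | hl
    · rw [sign_gap_of_le (by nlinarith), Real.sign_of_neg]
      have : (l : ℝ) ≤ 0 := by exact_mod_cast hl
      push_cast
      nlinarith
    · rw [sign_gap_of_lt (by nlinarith), Real.sign_of_pos]
      have : (1 : ℝ) ≤ l := by exact_mod_cast hl
      push_cast
      nlinarith
  rw [hsign, him, show (((2 * ((m : ℤ) + 1) * l - J : ℤ) : ℝ) + 2 * ((m : ℝ) + 1) *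
      ((z₁ - z₂).im / 2 / τ.im)) = ((m + 1) * (z₁ - z₂).im / τ.im -
        ((J - 2 * ((m : ℤ) + 1) * l : ℤ) : ℝ)) by push_cast; ring]

theorem zwegers_mul_theta (m s : ℕ) {J : ℤ}
    (hJ : J ∈ Finset.Icc (-(s : ℤ)) (-(s : ℤ) + 2 * (m : ℤ) + 1)) (τ z₁ z₂ : ℂ) (l i : ℤ) :
    zwegersTerm m J τ ((z₁ - z₂) / 2) (2 * ((m : ℤ) + 1) * l - J) *
      thetaTerm J (m + 1) τ (z₁ + z₂) i =
    errTerm m s τ z₁ z₂ (i + l, J - 2 * ((m : ℤ) + 1) * l) := by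
  have hm : (m : ℂ) + 1 ≠ 0 := by exact_mod_cast Nat.succ_ne_zero m
  rw [zwegersTerm_eq m s hJ, errTerm, thetaTerm, mul_assoc, mul_left_comm (ex _)]
  congr 1
  simp only [ex]
  rw [← Complex.exp_add, ← Complex.exp_add]
  congr 1
  push_cast
  field_simp
  ring

theorem summable_norm_zwegersTerm (m s : ℕ) {J : ℤ}
    (hJ : J ∈ Finset.Icc (-(s : ℤ)) (-(s : ℤ) + 2 * (m : ℤ) + 1)) {τ : ℂ} (hτ : 0 < τ.im)
    (z₁ z₂ : ℂ) :
    Summable fun l : ℤ => ‖zwegersTerm m J τ ((z₁ - z₂) / 2) (2 * ((m : ℤ) + 1) * l - J)‖ := by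
  have hm : (0 : ℝ) < (m : ℝ) + 1 := by positivity
  set ρ : ℝ := τ.im / (m + 1) with hρd
  have hρ : 0 < ρ := div_pos hτ hm
  set r : ℝ := (m + 1) * (z₁ - z₂).im / τ.im
  have hinj : Function.Injective fun l : ℤ => J - 2 * ((m : ℤ) + 1) * l := by
    intro a b h
    have h' : 2 * ((m : ℤ) + 1) * a = 2 * ((m : ℤ) + 1) * b := by
      simp only at h; linarith
    exact mul_left_cancel₀ (by positivity) h'
  -- The coefficient decays like `exp(-πρk²)` and the exponential grows like `exp(πρk²/2)`; half of
  -- the Gaussian decay survives.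
  have hs := ((summable_real_gaussian (a := Real.pi * ρ / 2) (by positivity)
    (2 * Real.pi * ρ * r - Real.pi * (z₁ - z₂).im) (-Real.pi * ρ * r ^ 2)).mul_left
    (2 * Real.exp (Real.pi * ρ * (-(s : ℤ) - 1 / 2 - r) ^ 2))).comp_injective hinj
  refine Summable.of_nonneg_of_le (fun _ => norm_nonneg _) (fun l => ?_) hs
  rw [zwegersTerm_eq m s hJ, norm_mul, Complex.norm_real, Real.norm_eq_abs]
  refine (mul_le_mul_of_nonneg_right (abs_gapCoeff_le hρ r s _) (norm_nonneg _)).trans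
    (le_of_eq ?_)
  rw [Function.comp, mul_assoc (2 * Real.exp _), Complex.norm_exp, ← Real.exp_add]
  congr 2
  have e : (-((Real.pi : ℂ) * I * ((2 * ((m : ℤ) + 1) * l - J : ℤ) : ℂ) ^ 2 /
        (2 * ((m : ℂ) + 1))) * τ
        - 2 * (Real.pi : ℂ) * I * ((2 * ((m : ℤ) + 1) * l - J : ℤ) : ℂ) * ((z₁ - z₂) / 2)) =
      ((-(Real.pi * ((J - 2 * ((m : ℤ) + 1) * l : ℤ) : ℝ) ^ 2 / (2 * (m + 1))) : ℝ) : ℂ) * (τ * I) +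
      ((Real.pi * ((J - 2 * ((m : ℤ) + 1) * l : ℤ) : ℝ) : ℝ) : ℂ) * ((z₁ - z₂) * I) := by
    push_cast; ring
  rw [e, add_re, re_ofReal_mul, re_ofReal_mul, mul_I_re, mul_I_re, hρd]
  field_simp
  ring

/-- Division of `k + s` by `2(m+1)` with remainder writes each pair `(j, k)` uniquely as `(i + l, J
- 2(m+1)l)` with `J` in the window, and in these variables the term factors into a term of `R` times
a term of `Θ`. -/
theorem tsum_errTerm (m s : ℕ) {τ : ℂ} (hτ : 0 < τ.im) (z₁ z₂ : ℂ) :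
    Summable (errTerm m s τ z₁ z₂) ∧
    ∑' p, errTerm m s τ z₁ z₂ p =
      ∑ J ∈ Finset.Icc (-(s : ℤ)) (-(s : ℤ) + 2 * (m : ℤ) + 1),
        zwegersR m J τ ((z₁ - z₂) / 2) * Theta J (m + 1) τ (z₁ + z₂) := by
  set S := Finset.Icc (-(s : ℤ)) (-(s : ℤ) + 2 * (m : ℤ) + 1) with hS
  let φ : S × (ℤ × ℤ) → ℤ × ℤ := fun x => (x.2.2 + x.2.1, x.1.1 - 2 * ((m : ℤ) + 1) * x.2.1)
  have hφ : Function.Bijective φ := by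
    constructor
    · rintro ⟨⟨J, hJ⟩, l, i⟩ ⟨⟨J', hJ'⟩, l', i'⟩ h
      rw [hS, Finset.mem_Icc] at hJ hJ'
      simp only [φ, Prod.mk.injEq] at h
      obtain ⟨h1, h2⟩ := h
      have hl : l = l' := by
        rcases lt_trichotomy l l' with h | h | h
        · nlinarith
        · exact h
        · nlinarith
      subst hl
      simp only [Prod.mk.injEq, Subtype.mk.injEq, true_and]
      omega
    · rintro ⟨j, k⟩
      have hpos : (0 : ℤ) < 2 * ((m : ℤ) + 1) := by positivity
      have h1 := Int.emod_nonneg (k + s) hpos.ne'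
      have h2 := Int.emod_lt_of_pos (k + s) hpos
      have h3 := Int.mul_ediv_add_emod (k + s) (2 * ((m : ℤ) + 1))
      refine ⟨⟨⟨-s + (k + s) % (2 * ((m : ℤ) + 1)), ?_⟩, -((k + s) / (2 * ((m : ℤ) + 1))),
        j + (k + s) / (2 * ((m : ℤ) + 1))⟩, ?_⟩
      · rw [hS, Finset.mem_Icc]; constructor <;> omega
      · simp only [φ, Prod.mk.injEq]
        constructor
        · ring
        · linarith
  let e := Equiv.ofBijective φ hφ
  have hterm : ∀ x : S × (ℤ × ℤ), errTerm m s τ z₁ z₂ (e x) =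
      zwegersTerm m x.1.1 τ ((z₁ - z₂) / 2) (2 * ((m : ℤ) + 1) * x.2.1 - x.1.1) *
        thetaTerm x.1.1 (m + 1) τ (z₁ + z₂) x.2.2 := fun x =>
    (zwegers_mul_theta m s x.1.2 τ z₁ z₂ x.2.1 x.2.2).symm
  have hfib : ∀ J : S, Summable fun p : ℤ × ℤ => ‖errTerm m s τ z₁ z₂ (e (J, p))‖ := fun J => by
    simp only [hterm]
    exact (summable_norm_zwegersTerm m s J.2 hτ z₁ z₂).mul_norm
      (summable_norm_thetaTerm J.1 (Nat.succ_pos m) hτ (z₁ + z₂))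
  have hsum' : Summable fun x : S × (ℤ × ℤ) => ‖errTerm m s τ z₁ z₂ (e x)‖ :=
    (summable_prod_of_nonneg fun _ => norm_nonneg _).2 ⟨hfib, Summable.of_finite⟩
  have hsum : Summable fun x : S × (ℤ × ℤ) => errTerm m s τ z₁ z₂ (e x) := hsum'.of_norm
  refine ⟨e.summable_iff.1 hsum, ?_⟩
  rw [← e.tsum_eq, hsum.tsum_prod, tsum_fintype, ← Finset.sum_coe_sort S]
  refine Finset.sum_congr rfl fun J _ => ?_
  simp only [hterm]
  rw [← tsum_mul_tsum_of_summable_norm (summable_norm_zwegersTerm m s J.2 hτ z₁ z₂)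
      (summable_norm_thetaTerm J.1 (Nat.succ_pos m) hτ (z₁ + z₂))]
  rfl

/-- Half of the completed function, as a lattice sum. -/
theorem Phi1_add_eq (m s : ℕ) {τ : ℂ} (hτ : 0 < τ.im) {z₁ : ℂ} (z₂ : ℂ)
    (hz : ¬ InLattice τ z₁) :
    Phi1 m s τ z₁ z₂ + 1 / 2 * ∑ J ∈ Finset.Icc (-(s : ℤ)) (-(s : ℤ) + 2 * (m : ℤ) + 1),
        zwegersR m J τ ((z₁ - z₂) / 2) * Theta J (m + 1) τ (z₁ + z₂) =
      -(2 * Real.pi * I)⁻¹ * (ex (-((m + 1 : ℕ) : ℂ) * z₁ * cr τ z₂) *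
        ∑' p : ℤ × ℤ, latTerm ((m + 1 : ℕ) : ℝ) τ z₁ z₂ p.1 p.2) := by
  have hm : (0 : ℝ) < (m : ℝ) + 1 := by positivity
  have hpi := Complex.two_pi_I_ne_zero
  obtain ⟨hs1, hs2⟩ := tsum_errTerm m s hτ z₁ z₂
  have hlat := (summable_norm_latTerm (κ := ((m + 1 : ℕ) : ℝ)) (by positivity) hτ z₁ z₂).of_norm
  have hint : ∀ j n : ℤ, z₁ + j * τ ≠ n := by
    intro j n h
    exact hz ⟨n, -j, by push_cast; linear_combination h⟩
  have hterm : ∀ j : ℤ, ex (((m : ℂ) + 1) * (j : ℂ) * (z₁ + z₂) - (s : ℂ) * z₁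
      + ((j : ℂ) ^ 2 * ((m : ℂ) + 1) - (j : ℂ) * (s : ℂ)) * τ)
      / (1 - ex (z₁ + (j : ℂ) * τ)) =
      -(2 * Real.pi * I)⁻¹ * (ex (-((m + 1 : ℕ) : ℂ) * z₁ * cr τ z₂) *
        ∑' n : ℤ, latTerm ((m + 1 : ℕ) : ℝ) τ z₁ z₂ j n) -
      1 / 2 * ∑' k : ℤ, errTerm m s τ z₁ z₂ (j, k) := by
    intro j
    -- The completion formula is applied in each row `w = z₁ + jτ`. The same `ρ` and `r` serve all
    -- rows, and `s` does not occur on the lattice side.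
    have h1 := tsum_gaussTerm_div (ρ := τ.im / ((m + 1 : ℕ) : ℝ)) (by positivity)
      (((m + 1 : ℕ) : ℝ) * (z₁ - z₂).im / τ.im) s (hint j)
    have h2 : ex (((m + 1 : ℕ) : ℂ) * j * (z₁ + z₂) + ((m + 1 : ℕ) : ℂ) * j ^ 2 * τ) *
        ∑' n : ℤ, gaussTerm (τ.im / ((m + 1 : ℕ) : ℝ)) (((m + 1 : ℕ) : ℝ) * (z₁ - z₂).im / τ.im)
          (z₁ + j * τ) n / (z₁ + j * τ + n) =
        ex (-((m + 1 : ℕ) : ℂ) * z₁ * cr τ z₂) *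
          ∑' n : ℤ, latTerm ((m + 1 : ℕ) : ℝ) τ z₁ z₂ j n := by
      rw [← tsum_mul_left, ← tsum_mul_left]
      exact tsum_congr fun n => gaussTerm_eq_latTerm (m + 1) hτ z₁ z₂ j n (Nat.succ_pos m)
    rw [← h2, h1, completedGeom]
    simp only [errTerm]
    rw [tsum_mul_left]
    push_cast
    rw [show ((m : ℂ) + 1) * (j : ℂ) * (z₁ + z₂) - (s : ℂ) * z₁
      + ((j : ℂ) ^ 2 * ((m : ℂ) + 1) - (j : ℂ) * (s : ℂ)) * τ =
      (((m : ℂ) + 1) * j * (z₁ + z₂) + ((m : ℂ) + 1) * j ^ 2 * τ) + (-s * (z₁ + j * τ)) by ring,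
      ex_add]
    field_simp
    ring
  rw [Phi1, tsum_congr hterm, Summable.tsum_sub, tsum_mul_left, tsum_mul_left, tsum_mul_left,
    ← hs1.tsum_prod, hs2, hlat.tsum_prod]
  · ring
  · exact (hlat.prod.mul_left _).mul_left _
  · exact hs1.prod.mul_left _

theorem Theta_neg_arg (j : ℤ) (n : ℕ) (τ z : ℂ) : Theta j n τ (-z) = Theta (-j) n τ z := by
  rw [Theta, Theta, ← (Equiv.neg ℤ).tsum_eq]
  refine tsum_congr fun k => ?_
  congr 1
  simp only [Equiv.neg_apply]; push_cast; ring

/-- The normalized lattice sum with poles at `z₁ ∈ ℤ + τ ℤ`. -/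
def latSum (m : ℕ) (τ z₁ z₂ : ℂ) : ℂ :=
  -(2 * Real.pi * I)⁻¹ * (ex (-((m + 1 : ℕ) : ℂ) * z₁ * cr τ z₂) *
        ∑' p : ℤ × ℤ, latTerm ((m + 1 : ℕ) : ℝ) τ z₁ z₂ p.1 p.2)

theorem cr_neg (τ z : ℂ) : cr τ (-z) = -cr τ z := by simp [cr]; ring

theorem cp_neg (τ z : ℂ) : cp τ (-z) = -cp τ z := by simp [cp]; ring

theorem latTerm_neg (κ : ℝ) (τ z₁ z₂ : ℂ) (α ν : ℝ) :
    latTerm κ τ (-z₁) (-z₂) (-α) (-ν) = -latTerm κ τ z₁ z₂ α ν := by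
  rw [latTerm, latTerm, cr_neg, cp_neg]
  rw [show -z₁ + ((-α : ℝ) : ℂ) * τ + ((-ν : ℝ) : ℂ) = -(z₁ + α * τ + ν) by push_cast; ring,
    norm_neg, div_neg]
  push_cast
  ring_nf

theorem latSum_neg (m : ℕ) (τ z₁ z₂ : ℂ) : latSum m τ (-z₁) (-z₂) = -latSum m τ z₁ z₂ := by
  rw [latSum, latSum, ← ((Equiv.neg ℤ).prodCongr (Equiv.neg ℤ)).tsum_eq]
  simp only [Equiv.prodCongr_apply, Prod.map, Equiv.neg_apply, Int.cast_neg, latTerm_neg, tsum_neg,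
    cr_neg]
  push_cast
  ring_nf

/-- The modified numerator as a sum of two lattice sums. -/
theorem PhiTilde_eq (m s : ℕ) {τ : ℂ} (hτ : 0 < τ.im) {z₁ z₂ : ℂ} (t : ℂ)
    (h₁ : ¬ InLattice τ z₁) (h₂ : ¬ InLattice τ z₂) :
    PhiTilde m s τ z₁ z₂ t =
      ex (((m : ℂ) + 1) * t) * (latSum m τ z₁ z₂ + latSum m τ z₂ z₁) := by
  have h₂' : ¬ InLattice τ (-z₂) := by
    rintro ⟨p, r, h⟩
    exact h₂ ⟨-p, -r, by push_cast; linear_combination -h⟩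
  have e1 := Phi1_add_eq m s hτ z₂ h₁
  -- The substitution `(z₁, z₂) ↦ (-z₂, -z₁)` fixes `z₁ - z₂` and negates `z₁ + z₂`: `R` is
  -- unchanged and `Θ_j` becomes `Θ_{-j}`, as in the correction. Oddness of the lattice sum turns
  -- the difference into a sum.
  have e2 := Phi1_add_eq m s hτ (-z₁) h₂'
  rw [← latSum] at e1 e2
  rw [latSum_neg, show (-z₂ - -z₁) / 2 = (z₁ - z₂) / 2 by ring,
    show -z₂ + -z₁ = -(z₁ + z₂) by ring] at e2
  simp only [Theta_neg_arg] at e2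
  rw [PhiTilde, Phi, PhiAdd]
  simp only [mul_sub, Finset.sum_sub_distrib]
  linear_combination ex (((m : ℂ) + 1) * t) * e1 - ex (((m : ℂ) + 1) * t) * e2

/-! ### Modular behaviour of the lattice sums and of the level `M` numerators -/

/-- Both `|z|²/Im τ` and the symplectic pairing of coordinates are invariant, the coordinates `(p,
r)` becoming `(r, -p)`; only the denominator contributes a factor `τ`. -/
theorem latTerm_S (κ : ℝ) {τ : ℂ} (hτ : 0 < τ.im) (z₁ z₂ : ℂ) (α ν : ℝ) :
    latTerm κ (-1 / τ) (z₁ / τ) (z₂ / τ) α ν = τ * latTerm κ τ z₁ z₂ ν (-α) := by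
  have hτ0 : τ ≠ 0 := by rintro rfl; simp at hτ
  have him : (-1 / τ).im = τ.im / ‖τ‖ ^ 2 := by
    rw [div_eq_mul_inv, neg_one_mul, Complex.neg_im, Complex.inv_im, Complex.normSq_eq_norm_sq]
    ring
  have hτ' : 0 < (-1 / τ).im := by
    rw [him]; exact div_pos hτ (by positivity)
  have hz : z₂ / τ = ((cr τ z₂ : ℝ) : ℂ) + ((-cp τ z₂ : ℝ) : ℂ) * (-1 / τ) := by
    have := coord_eq hτ z₂
    push_cast
    field_simp
    linear_combination this
  have hw : z₁ / τ + α * (-1 / τ) + ν = (z₁ + ν * τ + ((-α : ℝ) : ℂ)) / τ := by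
    push_cast; field_simp; ring
  rw [latTerm, latTerm, cr_eq hτ' hz, cp_eq hτ' hz, hw, him, norm_div, div_pow]
  have hn : ‖τ‖ ≠ 0 := norm_ne_zero_iff.2 hτ0
  rw [show Real.pi * κ / (τ.im / ‖τ‖ ^ 2) * (‖z₁ + ν * τ + ((-α : ℝ) : ℂ)‖ ^ 2 / ‖τ‖ ^ 2) =
    Real.pi * κ / τ.im * ‖z₁ + ν * τ + ((-α : ℝ) : ℂ)‖ ^ 2 by
      have := hτ.ne'; field_simp]
  push_cast
  rw [div_div_eq_mul_div]
  rw [show (κ : ℂ) * (α * cr τ z₂ - ν * -cp τ z₂) = κ * (ν * cp τ z₂ - -α * cr τ z₂) by ring]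
  ring

/-- The extra `z₁z₂/τ` is what the shift `t - z₁z₂/τ` compensates. -/
theorem S_prefactor {τ : ℂ} (hτ : 0 < τ.im) (z₁ z₂ : ℂ) :
    -(z₁ / τ) * (cr (-1 / τ) (z₂ / τ) : ℂ) = z₁ * z₂ / τ - z₁ * cr τ z₂ := by
  have hτ0 : τ ≠ 0 := by rintro rfl; simp at hτ
  have hτ' : 0 < (-1 / τ).im := by
    rw [div_eq_mul_inv, neg_one_mul, Complex.neg_im, Complex.inv_im]
    have := Complex.normSq_pos.2 hτ0
    rw [neg_div, neg_neg]; positivity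
  have h2 := coord_eq hτ z₂
  have hz : z₂ / τ = ((cr τ z₂ : ℝ) : ℂ) + ((-cp τ z₂ : ℝ) : ℂ) * (-1 / τ) := by
    push_cast
    field_simp
    linear_combination h2
  rw [cr_eq hτ' hz]
  push_cast
  field_simp
  linear_combination -z₁ * h2

/-- The twisted lattice sum attached to `Ψ~`. -/
def psiSum (M m : ℕ) (ε a b : ℝ) (τ z₁ z₂ : ℂ) : ℂ :=
  ∑' p : ℤ × ℤ, latTerm ((m + 1) / M) τ z₁ z₂ (a + p.1 * M) (ε + p.2) *
    ex ((((m + 1) / M * (p.1 * M * ε - (ε + p.2) * b) : ℝ)) : ℂ)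

/-- The part of `Ψ~` with poles in `z₁`. -/
def psiHalf (M m : ℕ) (ε a b : ℝ) (τ z₁ z₂ : ℂ) : ℂ :=
  -(2 * Real.pi * I)⁻¹ * (ex ((m + 1) / M * (-z₁ * cr τ z₂)) * psiSum M m ε a b τ z₁ z₂)

/-- The translated lattice of `Mτ` consists of points `ατ + ν` with `α ∈ a + Mℤ`, `ν ∈ ε + ℤ`, and
the Gaussian of parameter `m+1` for `Mτ` is that of parameter `(m+1)/M` for `τ`. The prefactors of
`Ψ~` absorb the shift up to a unitary phase. -/
theorem latSum_shift {M : ℕ} (hM : 0 < M) (m : ℕ) (ε a b : ℝ) {τ : ℂ} (hτ : 0 < τ.im) (z₁ z₂ : ℂ) :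
    ex (((m : ℂ) + 1) * a * b / M * τ) * ex (((m : ℂ) + 1) / M * (b * z₁ + a * z₂)) *
      latSum m (M * τ) (z₁ + a * τ + ε) (z₂ + b * τ + ε) = psiHalf M m ε a b τ z₁ z₂ := by
  have hM' : (0 : ℝ) < M := by exact_mod_cast hM
  have hMc : (M : ℂ) ≠ 0 := by exact_mod_cast hM.ne'
  have him : ((M : ℂ) * τ).im = M * τ.im := by simp
  have hMτ : 0 < ((M : ℂ) * τ).im := by rw [him]; positivity
  have h2 := coord_eq hτ z₂
  have hz : z₂ + b * τ + ε = ((cp τ z₂ + ε : ℝ) : ℂ) + (((cr τ z₂ + b) / M : ℝ) : ℂ) * (M * τ) := by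
    push_cast
    field_simp
    linear_combination h2
  rw [latSum, psiHalf, psiSum, mul_left_comm]
  congr 1
  rw [← tsum_mul_left, ← tsum_mul_left, ← tsum_mul_left]
  refine tsum_congr fun p => ?_
  rw [latTerm, latTerm, cr_eq hMτ hz, cp_eq hMτ hz, him]
  rw [show z₁ + a * τ + ε + ((p.1 : ℝ) : ℂ) * (M * τ) + ((p.2 : ℝ) : ℂ) =
    z₁ + ((a + p.1 * M : ℝ) : ℂ) * τ + ((ε + p.2 : ℝ) : ℂ) by push_cast; ring]
  rw [show Real.pi * ((m + 1 : ℕ) : ℝ) / (M * τ.im) = Real.pi * ((m + 1) / M) / τ.im by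
    push_cast; have := hτ.ne'; field_simp]
  generalize Complex.exp _ = E
  generalize z₁ + ((a + p.1 * M : ℝ) : ℂ) * τ + ((ε + p.2 : ℝ) : ℂ) = W
  have key : ex (((m : ℂ) + 1) * a * b / M * τ) * ex (((m : ℂ) + 1) / M * (b * z₁ + a * z₂)) *
      (ex (-((m + 1 : ℕ) : ℂ) * (z₁ + a * τ + ε) * (((cr τ z₂ + b) / M : ℝ) : ℂ)) *
        ex (((((m + 1 : ℕ) : ℝ)) : ℂ) * (((p.1 : ℝ) : ℂ) * ((cp τ z₂ + ε : ℝ) : ℂ) -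
          ((p.2 : ℝ) : ℂ) * (((cr τ z₂ + b) / M : ℝ) : ℂ)))) =
      ex (((m : ℂ) + 1) / M * (-z₁ * cr τ z₂)) *
        (ex ((((m + 1) / M : ℝ) : ℂ) * (((a + p.1 * M : ℝ) : ℂ) * cp τ z₂ -
          ((ε + p.2 : ℝ) : ℂ) * cr τ z₂)) *
          ex ((((m + 1) / M * (p.1 * M * ε - (ε + p.2) * b) : ℝ)) : ℂ)) := by
    simp only [← ex_add]
    congr 1
    generalize cp τ z₂ = p₂ at *
    generalize cr τ z₂ = r₂ at *
    rw [h2]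
    push_cast
    field_simp
    ring
  linear_combination (E / W) * key

theorem summable_norm_latTerm_shift {κ : ℝ} (hκ : 0 < κ) {τ : ℂ} (hτ : 0 < τ.im) (z₁ z₂ : ℂ)
    (a b : ℝ) : Summable fun p : ℤ × ℤ => ‖latTerm κ τ z₁ z₂ (a + p.1) (b + p.2)‖ := by
  refine (summable_lattice_gaussian_div (c := Real.pi * κ / τ.im)
    (div_pos (mul_pos Real.pi_pos hκ) hτ) hτ (z₁ + a * τ + b)).congr fun p => ?_
  rw [norm_latTerm]
  rw [show z₁ + a * τ + b + (p.1 : ℂ) * τ + (p.2 : ℂ) =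
    z₁ + ((a + p.1 : ℝ) : ℂ) * τ + ((b + p.2 : ℝ) : ℂ) by push_cast; ring]

theorem sum_ex_character {M N : ℕ} (hM : 0 < M) (hN : Nat.Coprime M N) (t : ℤ) :
    ∑ b ∈ Finset.range M, ex (((-((N : ℝ) / M * (b * t)) : ℝ)) : ℂ) =
      if (M : ℤ) ∣ t then (M : ℂ) else 0 := by
  have hMc : (M : ℂ) ≠ 0 := by exact_mod_cast hM.ne'
  have hpow : ∀ b : ℕ, ex (((-((N : ℝ) / M * (b * t)) : ℝ)) : ℂ) = ex (-(N * t / M)) ^ b := by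
    intro b
    rw [← ex_nat_mul]; congr 1; push_cast; ring
  simp only [hpow]
  split_ifs with h
  · obtain ⟨c, rfl⟩ := h
    have : ex (-(N * ((M * c : ℤ) : ℂ) / M)) = 1 := by
      rw [show (-(N * ((M * c : ℤ) : ℂ) / M)) = ((-(N * c) : ℤ) : ℂ) by push_cast; field_simp]
      exact ex_int _
    simp only [this, one_pow, Finset.sum_const, Finset.card_range, nsmul_eq_mul, mul_one]
  · have hne : ex (-(N * t / M)) ≠ 1 := by
      intro h1
      obtain ⟨n, hn⟩ := (ex_eq_one_iff _).1 h1
      have h2 : (N : ℂ) * t = -(n * M) := by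
        field_simp at hn; linear_combination -hn
      have h3 : (N : ℤ) * t = -(n * M) := by exact_mod_cast h2
      have h4 : (M : ℤ) ∣ N * t := ⟨-n, by rw [h3]; ring⟩
      -- Coprimality enters here: multiplication by `N` is injective modulo `M`, so the character is
      -- trivial only when `M ∣ t`.
      exact h (Int.dvd_of_dvd_mul_right_of_gcd_one h4 (by simpa using hN))
    have hone : ex (-(N * t / M)) ^ M = 1 := by
      rw [← ex_nat_mul, show (M : ℂ) * -(N * t / M) = ((-(N * t) : ℤ) : ℂ) by
        push_cast; field_simp]
      exact ex_int _
    have := geom_sum_mul (ex (-(N * t / M))) M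
    rw [hone, sub_self] at this
    exact (mul_eq_zero.1 this).resolve_right (sub_ne_zero.2 hne)

/-- Summation over `ℤ` by residue classes. -/
theorem sum_range_tsum {M : ℕ} (hM : 0 < M) {f : ℤ × ℤ → ℂ} (hf : Summable fun p => ‖f p‖) :
    ∑ a ∈ Finset.range M, ∑' p : ℤ × ℤ, f (a + p.1 * M, p.2) = ∑' p, f p := by
  let φ : Finset.range M × (ℤ × ℤ) → ℤ × ℤ := fun x => (x.1.1 + x.2.1 * M, x.2.2)
  have hM' : (0 : ℤ) < M := by exact_mod_cast hM
  have hφ : Function.Bijective φ := by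
    constructor
    · rintro ⟨⟨a, ha⟩, i, n⟩ ⟨⟨a', ha'⟩, i', n'⟩ h
      rw [Finset.mem_range] at ha ha'
      simp only [φ, Prod.mk.injEq] at h
      obtain ⟨h1, rfl⟩ := h
      have ha1 : (a : ℤ) < M := by exact_mod_cast ha
      have ha2 : (a' : ℤ) < M := by exact_mod_cast ha'
      have hi : i = i' := by
        rcases lt_trichotomy i i' with h | h | h
        · nlinarith
        · exact h
        · nlinarith
      subst hi
      simp only [Prod.mk.injEq, Subtype.mk.injEq, and_true]
      omega
    · rintro ⟨j, k⟩
      have h1 := Int.emod_nonneg j hM'.ne'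
      have h2 := Int.emod_lt_of_pos j hM'
      have h3 := Int.mul_ediv_add_emod j M
      refine ⟨⟨⟨(j % M).toNat, ?_⟩, j / M, k⟩, ?_⟩
      · rw [Finset.mem_range]; omega
      · simp only [φ, Prod.mk.injEq, and_true]
        rw [Int.toNat_of_nonneg h1]
        linarith
  let e := Equiv.ofBijective φ hφ
  have hs : Summable fun x => f (e x) := (e.summable_iff (f := f)).2 hf.of_norm
  rw [← e.tsum_eq, hs.tsum_prod, tsum_fintype, ← Finset.sum_coe_sort (Finset.range M)]
  rfl

/-- The sum over `a₀` reunites the classes modulo `M` of the first lattice index. The sum over `b₀`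
is a character sum equal to `M` if `M ∣ p.2 + J` and to `0` otherwise; the surviving second
coordinates `ε' + p.2` are the numbers `-(a + iM)`, which `latTerm_S` produces on the left. -/
theorem psiSum_S {M : ℕ} (hM : 0 < M) (m : ℕ) (hcop : Nat.Coprime M (m + 1)) (ε ε' a b : ℝ)
    {J K : ℤ} (hJ : a + ε' = J) (hK : b + ε' = K) {τ : ℂ} (hτ : 0 < τ.im) (z₁ z₂ : ℂ) :
    (M : ℂ) * psiSum M m ε a b (-1 / τ) (z₁ / τ) (z₂ / τ) =
      τ * ∑ a₀ ∈ Finset.range M, ∑ b₀ ∈ Finset.range M,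
        ex ((-((m + 1) / M * ((a₀ + ε) * b + (b₀ + ε) * a)) : ℝ) : ℂ) *
          psiSum M m ε' (a₀ + ε) (b₀ + ε) τ z₁ z₂ := by
  have hM' : (0 : ℝ) < M := by exact_mod_cast hM
  have hMz : (M : ℤ) ≠ 0 := by exact_mod_cast hM.ne'
  have hMc : (M : ℂ) ≠ 0 := by exact_mod_cast hM.ne'
  have hκ : (0 : ℝ) < (m + 1) / M := by positivity
  let H : ℤ × ℤ → ℂ := fun p => latTerm ((m + 1) / M) τ z₁ z₂ (ε + p.1) (ε' + p.2) *
    ex ((-((m + 1) / M * ((ε + p.1) * b + ε * (p.2 + J))) : ℝ) : ℂ)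
  have hH : Summable fun p => ‖H p‖ := by
    refine (summable_norm_latTerm_shift hκ hτ z₁ z₂ ε ε').congr fun p => ?_
    rw [norm_mul, norm_ex_ofReal, mul_one]
  let H' : ℤ × ℤ → ℂ := fun p => H p * if (M : ℤ) ∣ p.2 + J then (M : ℂ) else 0
  have hH' : Summable fun p => ‖H' p‖ := by
    refine Summable.of_nonneg_of_le (fun _ => norm_nonneg _) (fun p => ?_) (hH.mul_right (M : ℝ))
    rw [norm_mul]
    refine mul_le_mul_of_nonneg_left ?_ (norm_nonneg _)
    split_ifs
    · simp
    · simp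
  have hterm : ∀ (a₀ b₀ : ℕ) (p : ℤ × ℤ),
      ex ((-((m + 1) / M * ((a₀ + ε) * b + (b₀ + ε) * a)) : ℝ) : ℂ) *
        (latTerm ((m + 1) / M) τ z₁ z₂ (a₀ + ε + p.1 * M) (ε' + p.2) *
          ex ((((m + 1) / M * (p.1 * M * ε' - (ε' + p.2) * (b₀ + ε)) : ℝ)) : ℂ)) =
      H (a₀ + p.1 * M, p.2) *
        ex (((-(((m + 1 : ℕ) : ℝ) / M * (b₀ * (p.2 + J : ℤ))) : ℝ)) : ℂ) := by
    intro a₀ b₀ p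
    simp only [H]
    rw [show (a₀ + ε + p.1 * M : ℝ) = ε + ((a₀ + p.1 * M : ℤ) : ℝ) by push_cast; ring]
    rw [mul_left_comm, mul_assoc (latTerm _ _ _ _ _ _), ← ex_add, ← ex_add]
    congr 1
    -- Moving the multiple `p.1 * M` into the first lattice index costs the phase of `(m+1) p.1 (b +
    -- ε')`, trivial because `b + ε'` is the integer `K`.
    refine ex_eq_of_sub_int ((m + 1) * p.1 * K) ?_
    have hJ' : (J : ℂ) = a + ε' := by exact_mod_cast hJ.symm
    have hK' : (K : ℂ) = b + ε' := by exact_mod_cast hK.symm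
    push_cast
    rw [hJ', hK']
    field_simp
    ring
  have hinj : ∀ a₀ : ℕ, Function.Injective fun p : ℤ × ℤ => ((a₀ + p.1 * M, p.2) : ℤ × ℤ) := by
    rintro a₀ ⟨i, n⟩ ⟨i', n'⟩ h
    simp only [Prod.mk.injEq, add_right_inj] at h
    exact Prod.ext (mul_right_cancel₀ hMz h.1) h.2
  have hR : ∑ a₀ ∈ Finset.range M, ∑ b₀ ∈ Finset.range M,
        ex ((-((m + 1) / M * ((a₀ + ε) * b + (b₀ + ε) * a)) : ℝ) : ℂ) *
          psiSum M m ε' (a₀ + ε) (b₀ + ε) τ z₁ z₂ = ∑' p, H' p := by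
    rw [← sum_range_tsum hM hH']
    refine Finset.sum_congr rfl fun a₀ _ => ?_
    simp only [psiSum, ← tsum_mul_left, hterm]
    rw [← Summable.tsum_finsetSum]
    · refine tsum_congr fun p => ?_
      rw [← Finset.mul_sum, sum_ex_character hM hcop]
    · intro b₀ _
      refine Summable.of_norm ?_
      simp only [norm_mul, norm_ex_ofReal, mul_one]
      exact hH.comp_injective (hinj a₀)
  -- This map parametrizes the indices that survive the character sum by those of the left side.
  let g : ℤ × ℤ → ℤ × ℤ := fun p => (p.2, -J - p.1 * M)
  have hg : Function.Injective g := by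
    rintro ⟨i, n⟩ ⟨i', n'⟩ h
    simp only [g, Prod.mk.injEq, sub_right_inj] at h
    exact Prod.ext (mul_right_cancel₀ hMz h.2) h.1
  have hsupp : Function.support H' ⊆ Set.range g := by
    rintro ⟨α, n⟩ h
    rw [Function.mem_support] at h
    have hd : (M : ℤ) ∣ n + J := by
      by_contra hc
      exact h (by simp [H', hc])
    obtain ⟨c, hc⟩ := hd
    refine ⟨(-c, α), ?_⟩
    simp only [g, Prod.mk.injEq, true_and]
    linarith
  rw [hR, ← hg.tsum_eq hsupp, psiSum, ← tsum_mul_left, ← tsum_mul_left]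
  refine tsum_congr fun p => ?_
  have hd : (M : ℤ) ∣ -J - p.1 * M + J := ⟨-p.1, by ring⟩
  simp only [g, H', H, hd, if_true]
  rw [latTerm_S _ hτ, show (-(a + p.1 * M) : ℝ) = ε' + ((-J - p.1 * M : ℤ) : ℝ) by
    push_cast; rw [← hJ]; ring]
  rw [show ((m + 1) / M * (p.1 * M * ε - (ε + p.2) * b) : ℝ) =
    -((m + 1) / M * ((ε + p.2) * b + ε * (((-J - p.1 * M : ℤ) : ℝ) + J))) by push_cast; ring]
  ring

theorem psiHalf_S {M : ℕ} (hM : 0 < M) (m : ℕ) (hcop : Nat.Coprime M (m + 1)) (ε ε' a b : ℝ)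
    {J K : ℤ} (hJ : a + ε' = J) (hK : b + ε' = K) {τ : ℂ} (hτ : 0 < τ.im) (z₁ z₂ : ℂ) :
    psiHalf M m ε a b (-1 / τ) (z₁ / τ) (z₂ / τ) =
      ex ((m + 1) / M * (z₁ * z₂ / τ)) * τ * (1 / M) *
      ∑ a₀ ∈ Finset.range M, ∑ b₀ ∈ Finset.range M,
        ex ((-((m + 1) / M * ((a₀ + ε) * b + (b₀ + ε) * a)) : ℝ) : ℂ) *
          psiHalf M m ε' (a₀ + ε) (b₀ + ε) τ z₁ z₂ := by
  have hMc : (M : ℂ) ≠ 0 := by exact_mod_cast hM.ne'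
  have h := psiSum_S hM m hcop ε ε' a b hJ hK hτ z₁ z₂
  have h' : psiSum M m ε a b (-1 / τ) (z₁ / τ) (z₂ / τ) = 1 / M *
      ((M : ℂ) * psiSum M m ε a b (-1 / τ) (z₁ / τ) (z₂ / τ)) := by field_simp
  simp only [psiHalf]
  rw [h', h, S_prefactor hτ, sub_eq_add_neg, mul_add, ex_add, ← neg_mul]
  simp only [Finset.mul_sum]
  refine Finset.sum_congr rfl fun a₀ _ => Finset.sum_congr rfl fun b₀ _ => ?_
  ring

theorem latTerm_T (κ : ℝ) {τ : ℂ} (hτ : 0 < τ.im) (z₁ z₂ : ℂ) (α ν : ℝ) :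
    latTerm κ (τ + 1) z₁ z₂ α ν = latTerm κ τ z₁ z₂ α (α + ν) := by
  have him : (τ + 1).im = τ.im := by simp
  have hz : z₂ = ((cp τ z₂ - cr τ z₂ : ℝ) : ℂ) + (cr τ z₂ : ℂ) * (τ + 1) := by
    have := coord_eq hτ z₂
    push_cast
    linear_combination this
  rw [latTerm, latTerm, cr_eq (by rwa [him]) hz, cp_eq (by rwa [him]) hz, him]
  rw [show z₁ + α * (τ + 1) + ν = z₁ + α * τ + ((α + ν : ℝ) : ℂ) by push_cast; ring]
  congr 3
  push_cast; ring

/-- The shear sends `ν` to `α + ν`, hence the class `ε` to that of `a + ε`, which is `ε₁` modulo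
`ℤ`. Reindexing leaves one constant phase and, since `b + ε - ε₁` is an integer, nothing else. -/
theorem psiHalf_T {M : ℕ} (hM : 0 < M) (m : ℕ) (ε ε₁ a b : ℝ)
    {c d : ℤ} (hc : a + ε = ε₁ + c) (hd : b + ε = ε₁ + d) {τ : ℂ} (hτ : 0 < τ.im) (z₁ z₂ : ℂ) :
    psiHalf M m ε a b (τ + 1) z₁ z₂ =
      ex ((m + 1) / M * (a * b)) * psiHalf M m ε₁ a b τ z₁ z₂ := by
  have hMc : (M : ℂ) ≠ 0 := by exact_mod_cast hM.ne'
  have hcr : cr (τ + 1) z₂ = cr τ z₂ := by simp [cr]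
  have key : psiSum M m ε a b (τ + 1) z₁ z₂ =
      ex ((m + 1) / M * (a * b)) * psiSum M m ε₁ a b τ z₁ z₂ := by
    let e : ℤ × ℤ ≃ ℤ × ℤ :=
      { toFun := fun p => (p.1, p.2 - c - p.1 * M)
        invFun := fun p => (p.1, p.2 + c + p.1 * M)
        left_inv := fun p => Prod.ext rfl (by ring)
        right_inv := fun p => Prod.ext rfl (by ring) }
    rw [psiSum, psiSum, ← e.tsum_eq, ← tsum_mul_left]
    refine tsum_congr fun p => ?_
    simp only [e, Equiv.coe_fn_mk]
    rw [latTerm_T _ hτ, show (a + p.1 * M + (ε + ((p.2 - c - p.1 * M : ℤ) : ℝ)) : ℝ) =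
      ε₁ + p.2 by push_cast; linear_combination hc, mul_left_comm, ← ex_add]
    congr 1
    refine ex_eq_of_sub_int ((m + 1) * p.1 * d) ?_
    have hc' : (c : ℂ) = a + ε - ε₁ := by
      have : (a : ℂ) + ε = ε₁ + c := by exact_mod_cast hc
      linear_combination -this
    have hd' : (d : ℂ) = b + ε - ε₁ := by
      have : (b : ℂ) + ε = ε₁ + d := by exact_mod_cast hd
      linear_combination -this
    push_cast
    rw [hc', hd']
    field_simp
    ring
  rw [psiHalf, psiHalf, key, hcr]
  ring

theorem PsiTilde_eq {M : ℕ} (hM : 0 < M) (m s : ℕ) (ε a b : ℝ) {τ z₁ z₂ : ℂ} (t : ℂ)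
    (hτ : 0 < τ.im) (h₁ : ¬ InLattice τ (z₁ + ε + a * τ)) (h₂ : ¬ InLattice τ (z₂ + ε + b * τ)) :
    PsiTilde M m s ε a b τ z₁ z₂ t =
      ex ((m + 1) / M * t) * (psiHalf M m ε a b τ z₁ z₂ + psiHalf M m ε b a τ z₂ z₁) := by
  have hMτ : 0 < ((M : ℂ) * τ).im := by
    have : (0 : ℝ) < M := by exact_mod_cast hM
    rw [show ((M : ℂ) * τ).im = M * τ.im by simp]; positivity
  have sub : ∀ w : ℂ, InLattice (M * τ) w → InLattice τ w := by
    rintro w ⟨p, r, h⟩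
    exact ⟨p, r * M, by rw [h]; push_cast; ring⟩
  have e1 : z₁ + a * τ + ε = z₁ + ε + a * τ := by ring
  have e2 : z₂ + b * τ + ε = z₂ + ε + b * τ := by ring
  rw [PsiTilde, PhiTilde_eq m s hMτ (t / M) (fun h => h₁ (e1 ▸ sub _ h))
    (fun h => h₂ (e2 ▸ sub _ h)), ← latSum_shift hM m ε a b hτ, ← latSum_shift hM m ε b a hτ]
  rw [show ((m : ℂ) + 1) * (t / M) = (m + 1) / M * t by ring,
    show ((m : ℂ) + 1) * b * a / M * τ = (m + 1) * a * b / M * τ by ring,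
    show ((m : ℂ) + 1) / M * (a * z₂ + b * z₁) = (m + 1) / M * (b * z₁ + a * z₂) by ring]
  ring

/-! ### Infinite products and the Jacobi triple product -/

/-- `∏_{n ≥ 1} (1 - x qⁿ)`. -/
def qProd (q x : ℂ) : ℂ := ∏' n : ℕ, (1 + -(x * q ^ (n + 1)))

theorem norm_ex_lt_one {τ : ℂ} (hτ : 0 < τ.im) : ‖ex τ‖ < 1 := by
  rw [norm_ex, Real.exp_lt_one_iff]
  have := mul_pos Real.two_pi_pos hτ
  linarith

theorem summable_qProd {q : ℂ} (hq : ‖q‖ < 1) (x : ℂ) :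
    Summable fun n : ℕ => ‖-(x * q ^ (n + 1))‖ := by
  simp only [norm_neg, norm_mul, norm_pow]
  exact ((summable_nat_add_iff 1).2 (summable_geometric_of_lt_one (norm_nonneg _) hq)).mul_left _

theorem multipliable_qProd {q : ℂ} (hq : ‖q‖ < 1) (x : ℂ) :
    Multipliable fun n : ℕ => (1 + -(x * q ^ (n + 1))) :=
  multipliable_one_add_of_summable (summable_qProd hq x)

theorem tendsto_qProd_one {q : ℂ} (hq : ‖q‖ < 1) : Tendsto (qProd q) (𝓝 1) (𝓝 (qProd q 1)) := by
  have h := Summable.hasProdUniformlyOn_nat_one_add (f := fun (n : ℕ) (x : ℂ) => -(x * q ^ (n + 1)))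
    (isCompact_closedBall (0 : ℂ) 2)
    (((summable_nat_add_iff 1).2 (summable_geometric_of_lt_one (norm_nonneg _) hq)).mul_left 2)
    (.of_forall fun n x hx => by
      rw [norm_neg, norm_mul, norm_pow]
      exact mul_le_mul_of_nonneg_right (by simpa using hx) (by positivity))
    (fun n => by fun_prop)
  have hc := h.tendstoUniformlyOn.continuousOn (.of_forall fun s => by fun_prop)
  exact (hc.continuousAt (Metric.closedBall_mem_nhds_of_mem (by simp))).tendsto

theorem qProd_one_ne_zero {q : ℂ} (hq : ‖q‖ < 1) : qProd q 1 ≠ 0 := by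
  refine tprod_one_add_ne_zero_of_summable (fun n h => ?_) (summable_qProd hq 1)
  have h1 : q ^ (n + 1) = 1 := by linear_combination -h
  have h2 := congrArg norm h1
  rw [norm_pow, norm_one] at h2
  have := pow_lt_one₀ (norm_nonneg q) hq (Nat.succ_ne_zero n)
  simp only [Nat.succ_eq_add_one] at this
  linarith

theorem ex_add_nat_mul (w τ : ℂ) (n : ℕ) : ex (w + n * τ) = ex w * ex τ ^ n := by
  rw [ex_add, ex_nat_mul]

theorem one_sub_ex_shift (w τ : ℂ) (n : ℕ) :
    1 - ex (w + ((n : ℂ) + 1) * τ) = 1 + -(ex w * ex τ ^ (n + 1)) := by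
  have := ex_add_nat_mul w τ (n + 1)
  push_cast at this
  rw [this]; ring

theorem tprod_one_sub_ex (τ : ℂ) :
    ∏' n : ℕ, (1 - ex (((n : ℂ) + 1) * τ)) = qProd (ex τ) 1 := by
  refine tprod_congr fun n => ?_
  have := one_sub_ex_shift 0 τ n
  rwa [zero_add, ex_zero] at this

theorem multipliable_one_sub_ex {τ : ℂ} (hτ : 0 < τ.im) (w : ℂ) :
    Multipliable fun n : ℕ => (1 - ex (w + (n : ℂ) * τ)) := by
  have h : Summable fun n : ℕ => ‖-(ex w * ex τ ^ n)‖ := by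
    simp only [norm_neg, norm_mul, norm_pow]
    exact (summable_geometric_of_lt_one (norm_nonneg _) (norm_ex_lt_one hτ)).mul_left _
  refine (multipliable_one_add_of_summable h).congr fun n => ?_
  rw [ex_add_nat_mul]; ring

theorem multipliable_one_sub_ex_succ {τ : ℂ} (hτ : 0 < τ.im) (w : ℂ) :
    Multipliable fun n : ℕ => (1 - ex (w + ((n : ℂ) + 1) * τ)) :=
  (multipliable_qProd (norm_ex_lt_one hτ) (ex w)).congr fun n => (one_sub_ex_shift w τ n).symm

theorem rootProd_eq {τ : ℂ} (hτ : 0 < τ.im) (w : ℂ) :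
    rootProd τ w = (1 - ex w) * qProd (ex τ) (ex w) * qProd (ex τ) (ex (-w)) := by
  rw [rootProd, (multipliable_one_sub_ex hτ w).tprod_mul (multipliable_one_sub_ex_succ hτ (-w))]
  rw [tprod_eq_zero_mul' (f := fun n : ℕ => 1 - ex (w + (n : ℂ) * τ))]
  · simp only [Nat.cast_zero, zero_mul, add_zero, Nat.cast_add, Nat.cast_one, one_sub_ex_shift]
    rfl
  · simpa using multipliable_one_sub_ex_succ hτ w

/-- The simple zero at `w = 0` comes from the factor `1 - ex w`; the remaining products tend to
their values at `1`. The limit links the theta function to `∏(1-qⁿ)²`. -/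
theorem tendsto_rootProd_div {τ : ℂ} (hτ : 0 < τ.im) :
    Tendsto (fun w => rootProd τ w / w) (𝓝[≠] 0) (𝓝 (-(2 * Real.pi * I) * qProd (ex τ) 1 ^ 2)) := by
  have hd : HasDerivAt (fun w : ℂ => 1 - ex w) (-(2 * Real.pi * I)) 0 := by
    have h1 : HasDerivAt (fun w : ℂ => 2 * Real.pi * I * w) (2 * Real.pi * I) 0 := by
      simpa using (hasDerivAt_id (0 : ℂ)).const_mul (2 * (Real.pi : ℂ) * I)
    have h2 := h1.cexp.const_sub 1
    refine h2.congr_deriv ?_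
    simp
  have hs := hd.tendsto_slope
  have hex : Tendsto ex (𝓝[≠] 0) (𝓝 1) := by
    have := continuous_ex.tendsto 0
    rw [ex_zero] at this
    exact this.mono_left nhdsWithin_le_nhds
  have hex' : Tendsto (fun w => ex (-w)) (𝓝[≠] 0) (𝓝 1) := by
    have := (continuous_ex.comp continuous_neg).tendsto 0
    simp only [Function.comp, neg_zero, ex_zero] at this
    exact this.mono_left nhdsWithin_le_nhds
  have hq := tendsto_qProd_one (norm_ex_lt_one hτ)
  refine ((hs.mul (hq.comp hex)).mul (hq.comp hex')).congr' ?_ |>.trans (le_of_eq ?_)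
  · filter_upwards [self_mem_nhdsWithin] with w hw
    rw [rootProd_eq hτ, slope_def_field]
    simp only [ex_zero, Function.comp]
    ring
  · congr 1; ring

/-- The finite `q`-Pochhammer symbol `(q; q)_n`. -/
def poch (q : ℂ) (n : ℕ) : ℂ := ∏ i ∈ Finset.range n, (1 - q ^ (i + 1))

/-- The reciprocal of `(q; q)_j`, zero for negative `j`. -/
def invPoch (q : ℂ) (j : ℤ) : ℂ := if j < 0 then 0 else (poch q j.toNat)⁻¹

theorem one_sub_pow_ne_zero {q : ℂ} (hq : ‖q‖ < 1) (n : ℕ) : 1 - q ^ (n + 1) ≠ 0 := by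
  intro h
  have h2 := congrArg norm (sub_eq_zero.1 h)
  rw [norm_pow, norm_one] at h2
  exact (pow_lt_one₀ (norm_nonneg q) hq (Nat.succ_ne_zero n)).ne' h2

theorem poch_ne_zero {q : ℂ} (hq : ‖q‖ < 1) (n : ℕ) : poch q n ≠ 0 :=
  Finset.prod_ne_zero_iff.2 fun i _ => one_sub_pow_ne_zero hq i

theorem poch_succ (q : ℂ) (n : ℕ) : poch q (n + 1) = poch q n * (1 - q ^ (n + 1)) :=
  Finset.prod_range_succ _ _

/-- With the value zero at negative indices the recursion holds for every integer: at `j = 0` the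
factor `1 - q⁰` vanishes. No boundary cases remain in the coefficient recurrence. -/
theorem invPoch_sub_one {q : ℂ} (hq : ‖q‖ < 1) (j : ℤ) :
    invPoch q (j - 1) = (1 - q ^ j) * invPoch q j := by
  rcases lt_trichotomy j 0 with h | rfl | h
  · rw [invPoch, invPoch, if_pos h, if_pos (by omega), mul_zero]
  · simp [invPoch]
  · obtain ⟨n, rfl⟩ : ∃ n : ℕ, j = n + 1 := ⟨(j - 1).toNat, by omega⟩
    have h1 := one_sub_pow_ne_zero hq n
    have h2 := poch_ne_zero hq n
    rw [invPoch, invPoch, if_neg (by omega), if_neg (by omega),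
      show ((n : ℤ) + 1 - 1).toNat = n by omega, show ((n : ℤ) + 1).toNat = n + 1 by omega, poch_succ,
      show q ^ ((n : ℤ) + 1) = q ^ (n + 1) by exact_mod_cast zpow_natCast q (n + 1)]
    field_simp

/-- The Laurent coefficient of the finite triple product. -/
def tripleCoeff (q : ℂ) (n : ℕ) (k : ℤ) : ℂ :=
  poch q (2 * n) * invPoch q (n - k) * invPoch q (n + k)

/-- The coefficients are `q`-binomials of `2n` over `n + k`, and this is the `q`-Pascal rule applied
twice. All reciprocals are reduced to those at `n + 1 - k` and `n + 1 + k`, after which it is a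
rational identity. -/
theorem tripleCoeff_succ {q : ℂ} (hq : ‖q‖ < 1) (hq0 : q ≠ 0) (n : ℕ) (k : ℤ) :
    tripleCoeff q (n + 1) k = (1 + q ^ (2 * n + 1)) * tripleCoeff q n k +
      q ^ ((n : ℤ) + 1 - k) * tripleCoeff q n (k - 1) +
      q ^ ((n : ℤ) + 1 + k) * tripleCoeff q n (k + 1) := by
  have hX1 := invPoch_sub_one hq ((n : ℤ) + 1 - k)
  have hX2 := invPoch_sub_one hq ((n : ℤ) + 1 - k - 1)
  have hY1 := invPoch_sub_one hq ((n : ℤ) + 1 + k)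
  have hY2 := invPoch_sub_one hq ((n : ℤ) + 1 + k - 1)
  rw [hX1, zpow_sub_one₀ hq0] at hX2
  rw [hY1, zpow_sub_one₀ hq0] at hY2
  have hab : q ^ ((n : ℤ) + 1 - k) * q ^ ((n : ℤ) + 1 + k) = q ^ (2 * n + 2) := by
    rw [← zpow_add₀ hq0, ← zpow_natCast]
    congr 1; push_cast; ring
  have hab' : q ^ (2 * n + 1) = q ^ ((n : ℤ) + 1 - k) * q ^ ((n : ℤ) + 1 + k) * q⁻¹ := by
    rw [hab]; field_simp; ring
  simp only [tripleCoeff]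
  rw [show 2 * (n + 1) = (2 * n + 1) + 1 by ring, poch_succ, poch_succ,
    show (2 * n + 1 + 1) = 2 * n + 2 by ring, ← hab, hab']
  rw [show (((n + 1 : ℕ) : ℤ) - k) = (n : ℤ) + 1 - k by push_cast; ring,
    show (((n + 1 : ℕ) : ℤ) + k) = (n : ℤ) + 1 + k by push_cast; ring,
    show (n : ℤ) - k = (n : ℤ) + 1 - k - 1 by ring, show (n : ℤ) + k = (n : ℤ) + 1 + k - 1 by ring,
    show (n : ℤ) - (k - 1) = (n : ℤ) + 1 - k by ring,
    show (n : ℤ) + (k - 1) = (n : ℤ) + 1 + k - 1 - 1 by ring,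
    show (n : ℤ) - (k + 1) = (n : ℤ) + 1 - k - 1 - 1 by ring,
    show (n : ℤ) + (k + 1) = (n : ℤ) + 1 + k by ring, hX1, hX2, hY1, hY2]
  field_simp
  ring

/-- The theta term of the triple product, `(-1)^k q^{k(k-1)/2} x^k`. -/
def tripleTerm (τ w : ℂ) (k : ℤ) : ℂ := ex (k * (w + 1 / 2 - τ / 2) + k ^ 2 / 2 * τ)

theorem tripleTerm_eq_jacobi (τ w : ℂ) (k : ℤ) :
    tripleTerm τ w k = jacobiTheta₂_term k (w + 1 / 2 - τ / 2) τ := by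
  rw [tripleTerm, ex, jacobiTheta₂_term]; congr 1; ring

theorem ex_half : ex (1 / 2) = -1 := by
  rw [ex, show 2 * (Real.pi : ℂ) * I * (1 / 2) = Real.pi * I by ring, Complex.exp_pi_mul_I]

theorem tripleTerm_pred (τ w : ℂ) (n : ℕ) (k : ℤ) :
    -ex (w + n * τ) * tripleTerm τ w (k - 1) = tripleTerm τ w k * ex τ ^ ((n : ℤ) + 1 - k) := by
  have h : -ex (w + n * τ) = ex (w + n * τ + 1 / 2) := by rw [ex_add (w + n * τ), ex_half]; ring
  rw [h, ← ex_int_mul, tripleTerm, tripleTerm, ← ex_add, ← ex_add]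
  congr 1; push_cast; ring

theorem tripleTerm_succ (τ w : ℂ) (n : ℕ) (k : ℤ) :
    -ex (-w + ((n : ℂ) + 1) * τ) * tripleTerm τ w (k + 1) =
      tripleTerm τ w k * ex τ ^ ((n : ℤ) + 1 + k) := by
  have h : -ex (-w + ((n : ℂ) + 1) * τ) = ex (-w + ((n : ℂ) + 1) * τ - 1 / 2) := by
    rw [ex_sub, ex_half]; ring
  rw [h, ← ex_int_mul, tripleTerm, tripleTerm, ← ex_add, ← ex_add]
  congr 1; push_cast; ring

/-- With `x = ex w`, the factor added at step `n` is `1 + q^{2n+1} - xqⁿ - x⁻¹q^{n+1}`. Its last two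
monomials shift `k` by one, which matches the three terms of `tripleCoeff_succ`. -/
theorem hasSum_finite_triple {τ : ℂ} (hτ : 0 < τ.im) (w : ℂ) (n : ℕ) :
    HasSum (fun k : ℤ => tripleTerm τ w k * tripleCoeff (ex τ) n k)
      (∏ i ∈ Finset.range n, (1 - ex (w + (i : ℂ) * τ)) * (1 - ex (-w + ((i : ℂ) + 1) * τ))) := by
  have hq := norm_ex_lt_one hτ
  induction n with
  | zero =>
    have h := hasSum_ite_eq (0 : ℤ) (1 : ℂ)
    refine h.congr_fun ?_
    intro k
    split_ifs with hk
    · subst hk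
      simp [tripleTerm, tripleCoeff, invPoch, poch, ex_zero]
    · rcases lt_or_gt_of_ne hk with h1 | h1
      · simp [tripleCoeff, invPoch, h1]
      · simp [tripleCoeff, invPoch, h1]
  | succ n ih =>
    rw [Finset.prod_range_succ]
    set A := ∏ i ∈ Finset.range n, (1 - ex (w + (i : ℂ) * τ)) * (1 - ex (-w + ((i : ℂ) + 1) * τ))
    have h1 := ih.mul_left (1 + ex τ ^ (2 * n + 1))
    have h2 := (((Equiv.subRight (1 : ℤ)).hasSum_iff (f := fun k : ℤ =>
      tripleTerm τ w k * tripleCoeff (ex τ) n k)).2 ih).mul_left (-ex (w + n * τ))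
    have h3 := (((Equiv.addRight (1 : ℤ)).hasSum_iff (f := fun k : ℤ =>
      tripleTerm τ w k * tripleCoeff (ex τ) n k)).2 ih).mul_left (-ex (-w + ((n : ℂ) + 1) * τ))
    have hval : A * ((1 - ex (w + (n : ℂ) * τ)) * (1 - ex (-w + ((n : ℂ) + 1) * τ))) =
        (1 + ex τ ^ (2 * n + 1)) * A + -ex (w + n * τ) * A + -ex (-w + ((n : ℂ) + 1) * τ) * A := by
      have : ex (w + (n : ℂ) * τ) * ex (-w + ((n : ℂ) + 1) * τ) = ex τ ^ (2 * n + 1) := by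
        rw [← ex_add, ← ex_nat_mul]; congr 1; push_cast; ring
      rw [← this]; ring
    rw [hval]
    refine ((h1.add h2).add h3).congr_fun fun k => ?_
    simp only [Function.comp, Equiv.subRight_apply, Equiv.coe_addRight]
    rw [tripleCoeff_succ hq (ex_ne_zero τ), ← mul_assoc (-ex (w + n * τ)), tripleTerm_pred,
      ← mul_assoc (-ex (-w + ((n : ℂ) + 1) * τ)), tripleTerm_succ]
    ring

theorem tendsto_poch {q : ℂ} (hq : ‖q‖ < 1) : Tendsto (poch q) atTop (𝓝 (qProd q 1)) := by
  refine ((multipliable_qProd hq 1).hasProd.tendsto_prod_nat).congr fun n => ?_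
  refine Finset.prod_congr rfl fun i _ => ?_
  ring

theorem tendsto_invPoch {q : ℂ} (hq : ‖q‖ < 1) {f : ℕ → ℤ} (hf : Tendsto f atTop atTop) :
    Tendsto (fun n => invPoch q (f n)) atTop (𝓝 (qProd q 1)⁻¹) := by
  have h1 : Tendsto (fun n => (f n).toNat) atTop atTop := by
    refine tendsto_atTop.2 fun b => ?_
    filter_upwards [hf.eventually_ge_atTop (b : ℤ)] with n hn
    omega
  refine (((tendsto_poch hq).inv₀ (qProd_one_ne_zero hq)).comp h1).congr' ?_
  filter_upwards [hf.eventually_ge_atTop 0] with n hn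
  rw [invPoch, if_neg (by omega)]
  rfl

theorem exists_tripleCoeff_bound {q : ℂ} (hq : ‖q‖ < 1) :
    ∃ B : ℝ, ∀ n k, ‖tripleCoeff q n k‖ ≤ B := by
  obtain ⟨B₁, h₁⟩ := (tendsto_poch hq).norm.bddAbove_range
  obtain ⟨B₂, h₂⟩ := ((tendsto_poch hq).inv₀ (qProd_one_ne_zero hq)).norm.bddAbove_range
  have h1 : ∀ n, ‖poch q n‖ ≤ B₁ := fun n => h₁ ⟨n, rfl⟩
  have h2 : ∀ n, ‖(poch q n)⁻¹‖ ≤ B₂ := fun n => h₂ ⟨n, rfl⟩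
  have hB₂ : 0 ≤ B₂ := (norm_nonneg _).trans (h2 0)
  have hB₁ : 0 ≤ B₁ := (norm_nonneg _).trans (h1 0)
  have h3 : ∀ j, ‖invPoch q j‖ ≤ B₂ := fun j => by
    rw [invPoch]; split_ifs
    · simpa using hB₂
    · exact h2 _
  refine ⟨B₁ * B₂ * B₂, fun n k => ?_⟩
  rw [tripleCoeff, norm_mul, norm_mul]
  gcongr
  · exact h1 _
  · exact h3 _
  · exact h3 _

/-- The Jacobi triple product identity. -/
theorem jacobi_triple_product {τ : ℂ} (hτ : 0 < τ.im) (w : ℂ) :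
    rootProd τ w * qProd (ex τ) 1 = jacobiTheta₂ (w + 1 / 2 - τ / 2) τ := by
  have hq := norm_ex_lt_one hτ
  have hne := qProd_one_ne_zero hq
  obtain ⟨B, hB⟩ := exists_tripleCoeff_bound hq
  have hsum : Summable fun k : ℤ => ‖tripleTerm τ w k‖ := by
    simp only [tripleTerm_eq_jacobi]
    exact ((summable_jacobiTheta₂_term_iff _ τ).2 hτ).norm
  -- For fixed `k` the `q`-binomial tends to `1/∏(1-qⁿ)`, and its uniform bound permits dominated
  -- convergence.
  have hlim : Tendsto (fun n : ℕ => ∑' k : ℤ, tripleTerm τ w k * tripleCoeff (ex τ) n k) atTop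
      (𝓝 (∑' k : ℤ, tripleTerm τ w k * (qProd (ex τ) 1)⁻¹)) := by
    refine tendsto_tsum_of_dominated_convergence (bound := fun k => ‖tripleTerm τ w k‖ * B)
      (hsum.mul_right B) (fun k => ?_) (.of_forall fun n k => ?_)
    · have hk1 : Tendsto (fun n : ℕ => (n : ℤ) - k) atTop atTop :=
        tendsto_atTop_add_const_right _ (-k) tendsto_natCast_atTop_atTop
      have hk2 : Tendsto (fun n : ℕ => (n : ℤ) + k) atTop atTop :=
        tendsto_atTop_add_const_right _ k tendsto_natCast_atTop_atTop
      have hk3 : Tendsto (fun n : ℕ => 2 * n) atTop atTop :=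
        tendsto_id.const_mul_atTop' (by norm_num)
      have h := ((((tendsto_poch hq).comp hk3).mul (tendsto_invPoch hq hk1)).mul
        (tendsto_invPoch hq hk2)).const_mul (tripleTerm τ w k)
      rw [mul_inv_cancel₀ hne, one_mul] at h
      exact h
    · rw [norm_mul]
      exact mul_le_mul_of_nonneg_left (hB n k) (norm_nonneg _)
  have hprod := ((multipliable_one_sub_ex hτ w).mul
    (multipliable_one_sub_ex_succ hτ (-w))).hasProd.tendsto_prod_nat
  simp only [(hasSum_finite_triple hτ w _).tsum_eq] at hlim
  have := tendsto_nhds_unique hprod hlim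
  rw [rootProd, this, tsum_mul_right, mul_assoc, inv_mul_cancel₀ hne, mul_one]
  exact tsum_congr fun k => tripleTerm_eq_jacobi τ w k

/-! ### Modular behaviour of the denominators -/

theorem S_im_pos {τ : ℂ} (hτ : 0 < τ.im) : 0 < (-1 / τ).im := by
  have hτ0 : τ ≠ 0 := by rintro rfl; simp at hτ
  rw [div_eq_mul_inv, neg_one_mul, Complex.neg_im, Complex.inv_im]
  have := Complex.normSq_pos.2 hτ0
  rw [neg_div, neg_neg]; positivity

/-- Only the independence of `c` from `w` matters: the denominator contains one theta factor above
and two below, and `∏(1-qⁿ)²` contributes another `c`, so all powers of `c` cancel. -/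
theorem rootProd_S {τ : ℂ} (hτ : 0 < τ.im) :
    ∃ c : ℂ, c ≠ 0 ∧ ∀ w, rootProd (-1 / τ) (w / τ) =
      c * ex ((w ^ 2 + w * (1 - τ)) / (2 * τ)) * rootProd τ w := by
  have hτ0 : τ ≠ 0 := by rintro rfl; simp at hτ
  have hτ' := S_im_pos hτ
  have hp := qProd_one_ne_zero (norm_ex_lt_one hτ)
  have hp' := qProd_one_ne_zero (norm_ex_lt_one hτ')
  have hs : (-I * τ) ^ (1 / 2 : ℂ) ≠ 0 := by
    rw [Complex.cpow_ne_zero_iff_of_exponent_ne_zero (by norm_num)]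
    exact mul_ne_zero (neg_ne_zero.2 I_ne_zero) hτ0
  refine ⟨(-I * τ) ^ (1 / 2 : ℂ) * ex ((1 / 2 - τ / 2) ^ 2 / (2 * τ)) * qProd (ex τ) 1 /
    qProd (ex (-1 / τ)) 1, ?_, fun w => ?_⟩
  · exact div_ne_zero (mul_ne_zero (mul_ne_zero hs (ex_ne_zero _)) hp) hp'
  · have h1 := jacobi_triple_product hτ w
    have h2 := jacobi_triple_product hτ' (w / τ)
    have h3 := jacobiTheta₂_functional_equation (w + 1 / 2 - τ / 2) τ
    have h4 : jacobiTheta₂ ((w + 1 / 2 - τ / 2) / τ) (-1 / τ) =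
        jacobiTheta₂ (w / τ + 1 / 2 - -1 / τ / 2) (-1 / τ) := by
      -- The two arguments differ by exactly `1`.
      rw [← jacobiTheta₂_add_left]
      congr 1; field_simp; ring
    have h5 : ex ((1 / 2 - τ / 2) ^ 2 / (2 * τ)) * ex ((w ^ 2 + w * (1 - τ)) / (2 * τ)) *
        cexp (-Real.pi * I * (w + 1 / 2 - τ / 2) ^ 2 / τ) = 1 := by
      rw [ex, ex, ← Complex.exp_add, ← Complex.exp_add, ← Complex.exp_zero]
      congr 1; field_simp; ring
    rw [h4, ← h2, ← h1] at h3
    have h6 : rootProd (-1 / τ) (w / τ) * qProd (ex (-1 / τ)) 1 =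
        (-I * τ) ^ (1 / 2 : ℂ) * (ex ((1 / 2 - τ / 2) ^ 2 / (2 * τ)) *
          ex ((w ^ 2 + w * (1 - τ)) / (2 * τ))) * (rootProd τ w * qProd (ex τ) 1) := by
      rw [h3]
      have hs' := mul_one_div_cancel hs
      generalize rootProd (-1 / τ) (w / τ) * qProd (ex (-1 / τ)) 1 = Y
      linear_combination -(Y * ((-I * τ) ^ (1 / 2 : ℂ) * (1 / (-I * τ) ^ (1 / 2 : ℂ)))) * h5 - Y * hs'
    rw [eq_div_of_mul_eq hp' h6]
    ring

theorem rootProd_add_one (τ w : ℂ) : rootProd τ (w + 1) = rootProd τ w := by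
  refine tprod_congr fun n => ?_
  rw [show w + 1 + (n : ℂ) * τ = w + n * τ + (1 : ℤ) by push_cast; ring, ex_add_int,
    show -(w + 1) + ((n : ℂ) + 1) * τ = -w + ((n : ℂ) + 1) * τ + (-1 : ℤ) by push_cast; ring,
    ex_add_int]

theorem rootProd_add_nat (τ w : ℂ) (n : ℕ) : rootProd τ (w + n) = rootProd τ w := by
  induction n with
  | zero => simp
  | succ n ih => rw [← ih, Nat.cast_succ, ← add_assoc, rootProd_add_one]

theorem rootProd_add_int (τ w : ℂ) (n : ℤ) : rootProd τ (w + n) = rootProd τ w := by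
  obtain ⟨k, rfl | rfl⟩ := n.eq_nat_or_neg
  · exact_mod_cast rootProd_add_nat τ w k
  · have := rootProd_add_nat τ (w + ((-(k : ℤ) : ℤ) : ℂ)) k
    rw [← this]; congr 1; push_cast; ring

theorem rootProd_T (τ w : ℂ) : rootProd (τ + 1) w = rootProd τ w := by
  refine tprod_congr fun n => ?_
  rw [show w + (n : ℂ) * (τ + 1) = w + n * τ + (n : ℤ) by push_cast; ring, ex_add_int,
    show -w + ((n : ℂ) + 1) * (τ + 1) = -w + ((n : ℂ) + 1) * τ + ((n + 1 : ℕ) : ℤ) by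
      push_cast; ring, ex_add_int]

/-- Divide the theta transformation by `w/τ` and let `w → 0`. This yields the law for `∏(1-qⁿ)²`
with the same unknown `c`, without a separate treatment of the eta function. -/
theorem qProd_ex_S {τ c : ℂ} (hτ : 0 < τ.im)
    (hc : ∀ w, rootProd (-1 / τ) (w / τ) =
      c * ex ((w ^ 2 + w * (1 - τ)) / (2 * τ)) * rootProd τ w) :
    qProd (ex (-1 / τ)) 1 ^ 2 = τ * c * qProd (ex τ) 1 ^ 2 := by
  have hτ0 : τ ≠ 0 := by rintro rfl; simp at hτ
  have hτ' := S_im_pos hτ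
  have hw : Tendsto (fun w : ℂ => w / τ) (𝓝[≠] 0) (𝓝[≠] 0) := by
    refine tendsto_nhdsWithin_iff.2 ⟨?_, ?_⟩
    · have : Continuous fun w : ℂ => w / τ := by fun_prop
      have h := this.tendsto 0
      rw [zero_div] at h
      exact h.mono_left nhdsWithin_le_nhds
    · filter_upwards [self_mem_nhdsWithin] with w hw
      exact div_ne_zero hw hτ0
  have h1 := (tendsto_rootProd_div hτ').comp hw
  have hE : Tendsto (fun w : ℂ => ex ((w ^ 2 + w * (1 - τ)) / (2 * τ))) (𝓝[≠] 0) (𝓝 1) := by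
    have hcont : Continuous fun w : ℂ => ex ((w ^ 2 + w * (1 - τ)) / (2 * τ)) :=
      continuous_ex.comp (by fun_prop)
    have h := hcont.tendsto 0
    simp only [ne_eq, OfNat.ofNat_ne_zero, not_false_eq_true, zero_pow, zero_mul, add_zero,
      zero_div, ex_zero] at h
    exact h.mono_left nhdsWithin_le_nhds
  have h2 := (hE.mul (tendsto_rootProd_div hτ)).const_mul (τ * c)
  have h3 := tendsto_nhds_unique (h1.congr' ?_) h2
  · have hpi := Complex.two_pi_I_ne_zero
    refine mul_left_cancel₀ (neg_ne_zero.2 hpi) ?_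
    linear_combination h3
  · filter_upwards [self_mem_nhdsWithin] with w hw
    have hw' : w ≠ 0 := hw
    simp only [Function.comp]
    rw [hc]
    field_simp

theorem Rhat_eq (ε ε' : ℝ) {e : ℤ} (he : 2 * ε = e) (τ z₁ z₂ t : ℂ) :
    Rhat ε ε' τ z₁ z₂ t = ex (t + ε' * (z₁ + z₂) + ε' ^ 2 * τ) * qProd (ex τ) 1 ^ 2 *
      rootProd τ ((z₁ + ε + ε' * τ) + (z₂ + ε + ε' * τ)) /
        (rootProd τ (z₁ + ε + ε' * τ) * rootProd τ (z₂ + ε + ε' * τ)) := by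
  have he' : (2 : ℂ) * ε = e := by exact_mod_cast he
  rw [Rhat, denom, tprod_one_sub_ex,
    show (z₁ + ε + ε' * τ) + (z₂ + ε + ε' * τ) = z₁ + ε' * τ + (z₂ + ε' * τ) + e by
      rw [← he']; ring, rootProd_add_int,
    show z₁ + ε' * τ + ε = z₁ + ε + ε' * τ by ring, show z₂ + ε' * τ + ε = z₂ + ε + ε' * τ by ring]

theorem Rhat_S (ε ε' : ℝ) {e e' : ℤ} (he : 2 * ε = e) (he' : 2 * ε' = e') {τ : ℂ} (hτ : 0 < τ.im)
    (z₁ z₂ t : ℂ) :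
    Rhat ε ε' (-1 / τ) (z₁ / τ) (z₂ / τ) (t - z₁ * z₂ / τ) =
      τ * ex (-(2 * ε * ε')) * Rhat ε' ε τ z₁ z₂ t := by
  have hτ0 : τ ≠ 0 := by rintro rfl; simp at hτ
  obtain ⟨c, hc0, hc⟩ := rootProd_S hτ
  have hc2 : (2 : ℂ) * ε' = e' := by exact_mod_cast he'
  rw [Rhat_eq ε ε' he, Rhat_eq ε' ε he', qProd_ex_S hτ hc]
  have hsh : ∀ z : ℂ, rootProd (-1 / τ) (z / τ + ε + ε' * (-1 / τ)) =
      c * ex (((z - ε' + ε * τ) ^ 2 + (z - ε' + ε * τ) * (1 - τ)) / (2 * τ)) *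
        rootProd τ (z + ε' + ε * τ) := by
    intro z
    -- Here `ε` and `ε'` change places; the sign of `ε'` is corrected by periodicity under the
    -- integer `2ε'`.
    rw [show z / τ + ε + ε' * (-1 / τ) = (z - ε' + ε * τ) / τ by field_simp; ring, hc,
      show z + ε' + ε * τ = z - ε' + ε * τ + e' by rw [← hc2]; ring, rootProd_add_int]
  have hsum : rootProd (-1 / τ) ((z₁ / τ + ε + ε' * (-1 / τ)) + (z₂ / τ + ε + ε' * (-1 / τ))) =
      c * ex ((((z₁ - ε' + ε * τ) + (z₂ - ε' + ε * τ)) ^ 2 +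
        ((z₁ - ε' + ε * τ) + (z₂ - ε' + ε * τ)) * (1 - τ)) / (2 * τ)) *
        rootProd τ ((z₁ + ε' + ε * τ) + (z₂ + ε' + ε * τ)) := by
    rw [show (z₁ / τ + ε + ε' * (-1 / τ)) + (z₂ / τ + ε + ε' * (-1 / τ)) =
        ((z₁ - ε' + ε * τ) + (z₂ - ε' + ε * τ)) / τ by field_simp; ring, hc,
      show (z₁ + ε' + ε * τ) + (z₂ + ε' + ε * τ) =
        (z₁ - ε' + ε * τ) + (z₂ - ε' + ε * τ) + ((2 * e' : ℤ) : ℂ) by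
        push_cast; rw [← hc2]; ring, rootProd_add_int]
  rw [hsh, hsh, hsum]
  have key : ex (t - z₁ * z₂ / τ + ε' * (z₁ / τ + z₂ / τ) + ε' ^ 2 * (-1 / τ)) *
      ex ((((z₁ - ε' + ε * τ) + (z₂ - ε' + ε * τ)) ^ 2 +
        ((z₁ - ε' + ε * τ) + (z₂ - ε' + ε * τ)) * (1 - τ)) / (2 * τ)) =
      ex (-(2 * ε * ε')) * ex (t + ε * (z₁ + z₂) + ε ^ 2 * τ) *
      (ex (((z₁ - ε' + ε * τ) ^ 2 + (z₁ - ε' + ε * τ) * (1 - τ)) / (2 * τ)) *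
        ex (((z₂ - ε' + ε * τ) ^ 2 + (z₂ - ε' + ε * τ) * (1 - τ)) / (2 * τ))) := by
    simp only [← ex_add]
    congr 1
    field_simp
    ring
  have hE1 := ex_ne_zero (((z₁ - ε' + ε * τ) ^ 2 + (z₁ - ε' + ε * τ) * (1 - τ)) / (2 * τ))
  have hE2 := ex_ne_zero (((z₂ - ε' + ε * τ) ^ 2 + (z₂ - ε' + ε * τ) * (1 - τ)) / (2 * τ))
  generalize ex (((z₁ - ε' + ε * τ) ^ 2 + (z₁ - ε' + ε * τ) * (1 - τ)) / (2 * τ)) = E₁ at *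
  generalize ex (((z₂ - ε' + ε * τ) ^ 2 + (z₂ - ε' + ε * τ) * (1 - τ)) / (2 * τ)) = E₂ at *
  generalize rootProd τ (z₁ + ε' + ε * τ) = a₁
  generalize rootProd τ (z₂ + ε' + ε * τ) = a₂
  generalize rootProd τ ((z₁ + ε' + ε * τ) + (z₂ + ε' + ε * τ)) = a₃
  generalize qProd (ex τ) 1 = P
  rw [show c * E₁ * a₁ * (c * E₂ * a₂) = (c ^ 2 * (E₁ * E₂)) * (a₁ * a₂) by ring,
    mul_div_assoc' (τ * _)]
  rw [← mul_div_mul_left _ (a₁ * a₂) (mul_ne_zero (pow_ne_zero 2 hc0) (mul_ne_zero hE1 hE2))]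
  congr 1
  linear_combination (τ * c ^ 2 * P ^ 2 * a₃) * key

theorem Rhat_T (ε ε' ε₁ : ℝ) {e e₁ d : ℤ} (he : 2 * ε = e) (he₁ : 2 * ε₁ = e₁)
    (hd : ε + ε' = ε₁ + d) (τ z₁ z₂ t : ℂ) :
    Rhat ε ε' (τ + 1) z₁ z₂ t = ex (ε' ^ 2) * Rhat ε₁ ε' τ z₁ z₂ t := by
  have hd' : (ε : ℂ) + ε' = ε₁ + d := by exact_mod_cast hd
  have hq : ex (τ + 1) = ex τ := by simpa using ex_add_int τ 1
  rw [Rhat_eq ε ε' he, Rhat_eq ε₁ ε' he₁, hq]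
  simp only [rootProd_T]
  have hsh : ∀ z : ℂ, z + ε + ε' * (τ + 1) = z + ε₁ + ε' * τ + d := fun z => by
    linear_combination hd'
  rw [hsh, hsh, rootProd_add_int, rootProd_add_int,
    show z₁ + ε₁ + ε' * τ + d + (z₂ + ε₁ + ε' * τ + d) =
      z₁ + ε₁ + ε' * τ + (z₂ + ε₁ + ε' * τ) + ((2 * d : ℤ) : ℂ) by push_cast; ring, rootProd_add_int,
    show t + ε' * (z₁ + z₂) + ε' ^ 2 * (τ + 1) = ε' ^ 2 + (t + ε' * (z₁ + z₂) + ε' ^ 2 * τ) by ring,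
    ex_add]
  ring

/-! ### The transformation formulas of the characters -/

theorem mem_halves {ε : ℝ} (h : ε ∈ halves) : ε = 0 ∨ ε = 1 / 2 := by
  simpa [halves] using h

theorem exists_int_two_mul {ε : ℝ} (h : ε ∈ halves) : ∃ e : ℤ, 2 * ε = e := by
  rcases mem_halves h with rfl | rfl
  · exact ⟨0, by simp⟩
  · exact ⟨1, by simp⟩

theorem mem_indices {M : ℕ} {ε j : ℝ} (h : j ∈ indices M ε) : ∃ n : ℕ, j = n + ε := by
  simp only [indices, Finset.mem_image] at h
  obtain ⟨n, _, h⟩ := h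
  exact ⟨n, h.symm⟩

theorem sum_indices (M : ℕ) (ε : ℝ) (f : ℝ → ℂ) :
    ∑ a ∈ indices M ε, f a = ∑ n ∈ Finset.range M, f (n + ε) := by
  rw [indices, Finset.sum_image]
  intro a _ b _ h
  simpa using h

theorem sign_mul_ex {ε ε' : ℝ} (h : ε ∈ halves) (h' : ε' ∈ halves) :
    (-1 : ℂ) ^ (4 * (ε : ℂ) * (ε' : ℂ)) * ex (-(2 * ε * ε')) = 1 := by
  rcases mem_halves h with rfl | rfl
  · simp [ex_zero]
  · rcases mem_halves h' with rfl | rfl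
    · simp [ex_zero]
    · rw [show (-(2 * ((1 / 2 : ℝ) : ℂ) * ((1 / 2 : ℝ) : ℂ))) = -(1 / 2) by push_cast; ring, ex_neg,
        ex_half, show 4 * ((1 / 2 : ℝ) : ℂ) * ((1 / 2 : ℝ) : ℂ) = 1 by push_cast; ring]
      norm_num

theorem inLattice_add_iff {τ : ℂ} (w : ℂ) (p r : ℤ) : InLattice τ (w + p + r * τ) ↔ InLattice τ w := by
  constructor
  · rintro ⟨a, b, h⟩
    exact ⟨a - p, b - r, by push_cast; linear_combination h⟩
  · rintro ⟨a, b, h⟩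
    exact ⟨a + p, b + r, by push_cast; linear_combination h⟩

theorem inLattice_S {τ w : ℂ} (hτ : τ ≠ 0) (h : InLattice (-1 / τ) (w / τ)) : InLattice τ w := by
  obtain ⟨p, r, h⟩ := h
  refine ⟨-r, p, ?_⟩
  field_simp at h
  push_cast
  linear_combination h

theorem inLattice_T {τ w : ℂ} (h : InLattice (τ + 1) w) : InLattice τ w := by
  obtain ⟨p, r, h⟩ := h
  exact ⟨p + r, r, by push_cast; linear_combination h⟩

theorem not_inLattice_S {τ z : ℂ} (hτ : τ ≠ 0) {ε ε' j : ℝ} {J : ℤ} (hJ : j + ε' = J)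
    (h : ¬ InLattice τ (z + ε' + ε * τ)) : ¬ InLattice (-1 / τ) (z / τ + ε + j * (-1 / τ)) := by
  intro hc
  have hJ' : (j : ℂ) + ε' = J := by exact_mod_cast hJ
  rw [show z / τ + ε + j * (-1 / τ) = (z + ε * τ - j) / τ by field_simp; ring] at hc
  refine h ((inLattice_add_iff _ (-J) 0).1 ?_)
  convert inLattice_S hτ hc using 1
  push_cast
  linear_combination hJ'

theorem not_inLattice_T {τ z : ℂ} {ε ε₁ ε' j : ℝ} {c d : ℤ} (hc : j = ε' + c)
    (hd : ε + ε' = ε₁ + d) (h : ¬ InLattice τ (z + ε₁ + ε' * τ)) :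
    ¬ InLattice (τ + 1) (z + ε + j * (τ + 1)) := by
  intro h'
  have hc' : (j : ℂ) = ε' + c := by exact_mod_cast hc
  have hd' : (ε : ℂ) + ε' = ε₁ + d := by exact_mod_cast hd
  refine h ((inLattice_add_iff _ (d + c) c).1 ?_)
  convert inLattice_T h' using 1
  push_cast
  linear_combination -hd' - (τ + 1) * hc'

theorem not_inLattice_shift {τ z : ℂ} {ε ε' : ℝ} (n : ℕ)
    (h : ¬ InLattice τ (z + ε + ε' * τ)) : ¬ InLattice τ (z + ε + ((n + ε' : ℝ) : ℂ) * τ) := by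
  intro h'
  refine h ((inLattice_add_iff _ 0 n).1 ?_)
  convert h' using 1
  push_cast; ring

theorem PsiTilde_S {M m : ℕ} (s : ℕ) (hM : 0 < M) (hcop : Nat.Coprime M (m + 1)) {ε ε' : ℝ}
    (hε' : ε' ∈ halves) {j k : ℝ} (hj : j ∈ indices M ε')
    (hk : k ∈ indices M ε') {τ z₁ z₂ : ℂ} (t : ℂ) (hτ : 0 < τ.im) (hreg : IsRegular ε' ε τ z₁ z₂) :
    PsiTilde M m s ε j k (-1 / τ) (z₁ / τ) (z₂ / τ) (t - z₁ * z₂ / τ) =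
      τ * (1 / (M : ℂ)) * ∑ a ∈ indices M ε, ∑ b ∈ indices M ε,
        Complex.exp (-(2 * (Real.pi : ℂ) * Complex.I * ((m : ℂ) + 1) / (M : ℂ))
                  * ((a : ℂ) * (k : ℂ) + (b : ℂ) * (j : ℂ))) *
          PsiTilde M m s ε' a b τ z₁ z₂ t := by
  have hτ0 : τ ≠ 0 := by rintro rfl; simp at hτ
  obtain ⟨e', he'⟩ := exists_int_two_mul hε'
  obtain ⟨j₀, rfl⟩ := mem_indices hj
  obtain ⟨k₀, rfl⟩ := mem_indices hk
  have hJ : ((j₀ : ℝ) + ε') + ε' = ((j₀ + e' : ℤ) : ℝ) := by push_cast; rw [← he']; ring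
  have hK : ((k₀ : ℝ) + ε') + ε' = ((k₀ + e' : ℤ) : ℝ) := by push_cast; rw [← he']; ring
  rw [PsiTilde_eq hM m s ε _ _ _ (S_im_pos hτ) (not_inLattice_S hτ0 hJ hreg.1)
    (not_inLattice_S hτ0 hK hreg.2.1), psiHalf_S hM m hcop ε ε' _ _ hJ hK hτ,
    psiHalf_S hM m hcop ε ε' _ _ hK hJ hτ, mul_sub, ex_sub]
  simp only [sum_indices]
  have hterm : ∀ a b : ℕ, Complex.exp (-(2 * (Real.pi : ℂ) * Complex.I * ((m : ℂ) + 1) / (M : ℂ))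
      * (((a + ε : ℝ) : ℂ) * ((k₀ + ε' : ℝ) : ℂ) + ((b + ε : ℝ) : ℂ) * ((j₀ + ε' : ℝ) : ℂ))) *
          PsiTilde M m s ε' (a + ε) (b + ε) τ z₁ z₂ t =
      ex ((m + 1) / M * t) *
      (ex ((-((m + 1) / M * ((a + ε) * (k₀ + ε') + (b + ε) * (j₀ + ε'))) : ℝ) : ℂ) *
          psiHalf M m ε' (a + ε) (b + ε) τ z₁ z₂ +
        ex ((-((m + 1) / M * ((b + ε) * (j₀ + ε') + (a + ε) * (k₀ + ε'))) : ℝ) : ℂ) *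
          psiHalf M m ε' (b + ε) (a + ε) τ z₂ z₁) := by
    intro a b
    rw [PsiTilde_eq hM m s ε' _ _ t hτ (not_inLattice_shift a hreg.1)
      (not_inLattice_shift b hreg.2.1), add_comm (((b : ℝ) + ε) * _), ← mul_add, mul_left_comm]
    congr 2
    rw [ex]
    congr 1
    push_cast; ring
  simp only [hterm, ← Finset.mul_sum, Finset.sum_add_distrib]
  -- In the half with poles in `z₂` the pairs `(j, k)` and `(a, b)` appear in reversed order, so its
  -- double sum is transposed.
  rw [Finset.sum_comm (f := fun a b : ℕ =>
    ex ((-((m + 1) / M * ((b + ε) * (j₀ + ε') + (a + ε) * (k₀ + ε'))) : ℝ) : ℂ) *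
          psiHalf M m ε' (b + ε) (a + ε) τ z₂ z₁)]
  rw [mul_comm z₂ z₁]
  have alg : ∀ A E S₁ S₂ : ℂ, E ≠ 0 → A / E * (E * τ * (1 / M) * S₁ + E * τ * (1 / M) * S₂) =
      τ * (1 / M) * (A * (S₁ + S₂)) := by
    intro A E S₁ S₂ hE
    field_simp
  exact alg _ _ _ _ (ex_ne_zero _)

theorem chTilde_S {M m : ℕ} (s : ℕ) (hM : 0 < M) (hcop : Nat.Coprime M (m + 1)) {ε ε' : ℝ}
    (hε : ε ∈ halves) (hε' : ε' ∈ halves) {j k : ℝ} (hj : j ∈ indices M ε')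
    (hk : k ∈ indices M ε') {τ z₁ z₂ : ℂ} (t : ℂ) (hτ : 0 < τ.im) (hreg : IsRegular ε' ε τ z₁ z₂) :
    chTilde M m s ε ε' j k (-1 / τ) (z₁ / τ) (z₂ / τ) (t - z₁ * z₂ / τ) =
      (-1 : ℂ) ^ (4 * (ε : ℂ) * (ε' : ℂ)) * (1 / (M : ℂ)) *
        ∑ a ∈ indices M ε, ∑ b ∈ indices M ε,
          Complex.exp (-(2 * (Real.pi : ℂ) * Complex.I * ((m : ℂ) + 1) / (M : ℂ))
              * ((a : ℂ) * (k : ℂ) + (b : ℂ) * (j : ℂ))) *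
            chTilde M m s ε' ε a b τ z₁ z₂ t := by
  have hτ0 : τ ≠ 0 := by rintro rfl; simp at hτ
  obtain ⟨e, he⟩ := exists_int_two_mul hε
  obtain ⟨e', he'⟩ := exists_int_two_mul hε'
  have hsg := sign_mul_ex hε hε'
  have hne := ex_ne_zero (-(2 * ε * ε'))
  simp only [chTilde, mul_div_assoc', ← Finset.sum_div]
  rw [PsiTilde_S s hM hcop hε' hj hk t hτ hreg, Rhat_S ε ε' he he' hτ, mul_assoc τ, mul_assoc τ,
    mul_div_mul_left _ _ hτ0, ← mul_div_mul_left _ (Rhat ε' ε τ z₁ z₂ t) hne]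
  congr 1
  linear_combination (-(1 / (M : ℂ)) * ∑ a ∈ indices M ε, ∑ b ∈ indices M ε,
        Complex.exp (-(2 * (Real.pi : ℂ) * Complex.I * ((m : ℂ) + 1) / (M : ℂ))
                  * ((a : ℂ) * (k : ℂ) + (b : ℂ) * (j : ℂ))) *
          PsiTilde M m s ε' a b τ z₁ z₂ t) * hsg

theorem exists_int_add_eq {ε ε' : ℝ} (h : ε ∈ halves) (h' : ε' ∈ halves) :
    |ε - ε'| ∈ halves ∧ ∃ d : ℤ, ε + ε' = |ε - ε'| + d := by
  rcases mem_halves h with rfl | rfl <;> rcases mem_halves h' with rfl | rfl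
  · exact ⟨by simp [halves], 0, by simp⟩
  · refine ⟨?_, 0, ?_⟩
    · rw [show |(0 : ℝ) - 1 / 2| = 1 / 2 by norm_num [abs_of_pos]]; exact h'
    · norm_num [abs_of_pos]
  · refine ⟨?_, 0, ?_⟩
    · rw [show |(1 / 2 : ℝ) - 0| = 1 / 2 by norm_num [abs_of_pos]]; exact h
    · norm_num [abs_of_pos]
  · exact ⟨by simp [halves], 1, by norm_num⟩

theorem chTilde_T {M m : ℕ} (s : ℕ) (hM : 0 < M) {ε ε' : ℝ}
    (hε : ε ∈ halves) (hε' : ε' ∈ halves) {j k : ℝ} (hj : j ∈ indices M ε')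
    (hk : k ∈ indices M ε') {τ z₁ z₂ : ℂ} (t : ℂ) (hτ : 0 < τ.im)
    (hreg : IsRegular |ε - ε'| ε' τ z₁ z₂) :
    chTilde M m s ε ε' j k (τ + 1) z₁ z₂ t =
      Complex.exp (2 * (Real.pi : ℂ) * Complex.I * (((m : ℂ) + 1) * (j : ℂ) * (k : ℂ) / (M : ℂ))
              - (Real.pi : ℂ) * Complex.I * (ε' : ℂ)) *
        chTilde M m s |ε - ε'| ε' j k τ z₁ z₂ t := by
  have hτ1 : 0 < (τ + 1).im := by simpa using hτ
  obtain ⟨h₁, d, hd⟩ := exists_int_add_eq hε hε'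
  generalize |ε - ε'| = ε₁ at *
  obtain ⟨e, he⟩ := exists_int_two_mul hε
  obtain ⟨e₁, he₁⟩ := exists_int_two_mul h₁
  obtain ⟨j₀, rfl⟩ := mem_indices hj
  obtain ⟨k₀, rfl⟩ := mem_indices hk
  have hc : ((j₀ : ℝ) + ε') + ε = ε₁ + ((j₀ + d : ℤ) : ℝ) := by push_cast; linear_combination hd
  have hc' : ((k₀ : ℝ) + ε') + ε = ε₁ + ((k₀ + d : ℤ) : ℝ) := by push_cast; linear_combination hd
  rw [chTilde, chTilde, Rhat_T ε ε' ε₁ he he₁ hd,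
    PsiTilde_eq hM m s ε _ _ _ hτ1
      (not_inLattice_T (c := j₀) (by push_cast; ring) hd hreg.1)
      (not_inLattice_T (c := k₀) (by push_cast; ring) hd hreg.2.1),
    PsiTilde_eq hM m s ε₁ _ _ _ hτ (not_inLattice_shift j₀ hreg.1) (not_inLattice_shift k₀ hreg.2.1),
    psiHalf_T hM m ε ε₁ _ _ hc hc' hτ, psiHalf_T hM m ε ε₁ _ _ hc' hc hτ,
    mul_comm (((k₀ + ε' : ℝ)) : ℂ) (((j₀ + ε' : ℝ)) : ℂ), ← mul_add]
  have hexp : Complex.exp (2 * (Real.pi : ℂ) * Complex.I *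
      (((m : ℂ) + 1) * ((j₀ + ε' : ℝ) : ℂ) * ((k₀ + ε' : ℝ) : ℂ) / (M : ℂ))
              - (Real.pi : ℂ) * Complex.I * (ε' : ℂ)) =
      ex ((m + 1) / M * (((j₀ + ε' : ℝ) : ℂ) * ((k₀ + ε' : ℝ) : ℂ))) / ex (ε' ^ 2) := by
    rw [← ex_sub, ex]
    congr 1
    -- For `ε' ∈ {0, 1/2}` one has `ε'² = ε'/2`, which turns the denominator's phase into
    -- `exp(-πiε')`.
    rcases mem_halves hε' with rfl | rfl
    · push_cast; ring
    · push_cast; ring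
  rw [hexp]
  have hne := ex_ne_zero ((ε' : ℂ) ^ 2)
  rw [mul_left_comm, mul_div_mul_comm]

/-! ### Invariance of the span under the modular group -/

/-- The common domain of the whole family of characters. -/
def AllRegular (τ z₁ z₂ : ℂ) : Prop :=
  ∀ δ ∈ halves, ∀ δ' ∈ halves, IsRegular δ δ' τ z₁ z₂

/-- The functions that agree on the common domain with an element of the span. -/
def InSpan (M m s : ℕ) (f : ℂ → ℂ → ℂ → ℂ → ℂ) : Prop :=
  ∃ C : ℝ → ℝ → ℝ → ℝ → ℂ, ∀ τ z₁ z₂ t : ℂ, 0 < τ.im → AllRegular τ z₁ z₂ →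
    f τ z₁ z₂ t = ∑ δ ∈ halves, ∑ δ' ∈ halves, ∑ a ∈ indices M δ', ∑ b ∈ indices M δ',
      C δ δ' a b * chTilde M m s δ δ' a b τ z₁ z₂ t

theorem InSpan.congr {M m s : ℕ} {f g : ℂ → ℂ → ℂ → ℂ → ℂ} (hf : InSpan M m s f)
    (h : ∀ τ z₁ z₂ t : ℂ, 0 < τ.im → AllRegular τ z₁ z₂ → g τ z₁ z₂ t = f τ z₁ z₂ t) :
    InSpan M m s g := by
  obtain ⟨C, hC⟩ := hf
  exact ⟨C, fun τ z₁ z₂ t hτ hr => (h τ z₁ z₂ t hτ hr).trans (hC τ z₁ z₂ t hτ hr)⟩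

theorem InSpan.mul_left {M m s : ℕ} {f : ℂ → ℂ → ℂ → ℂ → ℂ} (hf : InSpan M m s f) (c : ℂ) :
    InSpan M m s fun τ z₁ z₂ t => c * f τ z₁ z₂ t := by
  obtain ⟨C, hC⟩ := hf
  refine ⟨fun δ δ' a b => c * C δ δ' a b, fun τ z₁ z₂ t hτ hr => ?_⟩
  simp only [hC τ z₁ z₂ t hτ hr, Finset.mul_sum, mul_assoc]

theorem InSpan.add {M m s : ℕ} {f g : ℂ → ℂ → ℂ → ℂ → ℂ} (hf : InSpan M m s f)
    (hg : InSpan M m s g) : InSpan M m s fun τ z₁ z₂ t => f τ z₁ z₂ t + g τ z₁ z₂ t := by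
  obtain ⟨C, hC⟩ := hf
  obtain ⟨D, hD⟩ := hg
  refine ⟨fun δ δ' a b => C δ δ' a b + D δ δ' a b, fun τ z₁ z₂ t hτ hr => ?_⟩
  simp only [hC τ z₁ z₂ t hτ hr, hD τ z₁ z₂ t hτ hr, add_mul, Finset.sum_add_distrib]

theorem InSpan.sum {M m s : ℕ} {ι : Type*} (S : Finset ι) {f : ι → ℂ → ℂ → ℂ → ℂ → ℂ}
    (hf : ∀ i ∈ S, InSpan M m s (f i)) :
    InSpan M m s fun τ z₁ z₂ t => ∑ i ∈ S, f i τ z₁ z₂ t := by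
  classical
  induction S using Finset.induction_on with
  | empty => exact ⟨fun _ _ _ _ => 0, by simp⟩
  | insert i S hi ih =>
    simp only [Finset.sum_insert hi]
    exact (hf i (Finset.mem_insert_self _ _)).add
      (ih fun j hj => hf j (Finset.mem_insert_of_mem hj))

theorem inSpan_chTilde (M m s : ℕ) {ε ε' j k : ℝ} (hε : ε ∈ halves) (hε' : ε' ∈ halves)
    (hj : j ∈ indices M ε') (hk : k ∈ indices M ε') :
    InSpan M m s (chTilde M m s ε ε' j k) := by
  refine ⟨fun δ δ' a b => if δ = ε then if δ' = ε' then if a = j then if b = k then 1 else 0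
    else 0 else 0 else 0, fun τ z₁ z₂ t _ _ => ?_⟩
  rw [Finset.sum_eq_single_of_mem ε hε, Finset.sum_eq_single_of_mem ε' hε',
    Finset.sum_eq_single_of_mem j hj, Finset.sum_eq_single_of_mem k hk]
  · simp
  · intro b _ hb; simp [hb]
  · intro b _ hb; simp [hb]
  · intro b _ hb; simp [hb]
  · intro b _ hb; simp [hb]

/-- The automorphy factor `c τ + d`. -/
def autFactor (A : Matrix.SpecialLinearGroup (Fin 2) ℤ) (τ : ℂ) : ℂ :=
  (A 1 0 : ℤ) * τ + (A 1 1 : ℤ)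

/-- The action on `τ`. -/
def moeb (A : Matrix.SpecialLinearGroup (Fin 2) ℤ) (τ : ℂ) : ℂ :=
  ((A 0 0 : ℤ) * τ + (A 0 1 : ℤ)) / autFactor A τ

/-- Precomposition with the action of `SL₂(ℤ)`. -/
def actOn (A : Matrix.SpecialLinearGroup (Fin 2) ℤ) (f : ℂ → ℂ → ℂ → ℂ → ℂ) (τ z₁ z₂ t : ℂ) : ℂ :=
  f (moeb A τ) (z₁ / autFactor A τ) (z₂ / autFactor A τ)
    (t - (A 1 0 : ℤ) * z₁ * z₂ / autFactor A τ)

/-- `A` preserves the common domain and the span. -/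
structure Preserves (M m s : ℕ) (A : Matrix.SpecialLinearGroup (Fin 2) ℤ) : Prop where
  ne_zero : ∀ τ : ℂ, 0 < τ.im → autFactor A τ ≠ 0
  im_pos : ∀ τ : ℂ, 0 < τ.im → 0 < (moeb A τ).im
  regular : ∀ τ z₁ z₂ : ℂ, 0 < τ.im → AllRegular τ z₁ z₂ →
    AllRegular (moeb A τ) (z₁ / autFactor A τ) (z₂ / autFactor A τ)
  span : ∀ f, InSpan M m s f → InSpan M m s (actOn A f)

theorem Preserves.span_of_generators {M m s : ℕ} {A : Matrix.SpecialLinearGroup (Fin 2) ℤ}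
    (im_pos : ∀ τ : ℂ, 0 < τ.im → 0 < (moeb A τ).im)
    (regular : ∀ τ z₁ z₂ : ℂ, 0 < τ.im → AllRegular τ z₁ z₂ →
      AllRegular (moeb A τ) (z₁ / autFactor A τ) (z₂ / autFactor A τ))
    (h : ∀ ε ∈ halves, ∀ ε' ∈ halves, ∀ j ∈ indices M ε', ∀ k ∈ indices M ε',
      InSpan M m s (actOn A (chTilde M m s ε ε' j k))) (f : ℂ → ℂ → ℂ → ℂ → ℂ)
    (hf : InSpan M m s f) : InSpan M m s (actOn A f) := by
  obtain ⟨C, hC⟩ := hf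
  refine InSpan.congr (InSpan.sum halves fun δ hδ => InSpan.sum halves fun δ' hδ' =>
    InSpan.sum (indices M δ') fun a ha => InSpan.sum (indices M δ') fun b hb =>
      (h δ hδ δ' hδ' a ha b hb).mul_left (C δ δ' a b)) fun τ z₁ z₂ t hτ hr => ?_
  exact hC _ _ _ _ (im_pos τ hτ) (regular τ z₁ z₂ hτ hr)

theorem autFactor_mul (A B : Matrix.SpecialLinearGroup (Fin 2) ℤ) {τ : ℂ} (hB : autFactor B τ ≠ 0) :
    autFactor (A * B) τ = autFactor A (moeb B τ) * autFactor B τ := by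
  have h : autFactor A (moeb B τ) * autFactor B τ =
      (A 1 0 : ℤ) * ((B 0 0 : ℤ) * τ + (B 0 1 : ℤ)) + (A 1 1 : ℤ) * autFactor B τ := by
    rw [autFactor, moeb]; field_simp
  rw [h]
  simp only [autFactor, Matrix.SpecialLinearGroup.coe_mul, Matrix.mul_apply, Fin.sum_univ_two]
  push_cast; ring

theorem moeb_mul (A B : Matrix.SpecialLinearGroup (Fin 2) ℤ) {τ : ℂ}
    (hB : autFactor B τ ≠ 0) : moeb (A * B) τ = moeb A (moeb B τ) := by
  have h : ((A 0 0 : ℤ) * moeb B τ + (A 0 1 : ℤ)) * autFactor B τ =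
      (A 0 0 : ℤ) * ((B 0 0 : ℤ) * τ + (B 0 1 : ℤ)) + (A 0 1 : ℤ) * autFactor B τ := by
    rw [moeb]; field_simp
  rw [moeb, autFactor_mul A B hB, moeb.eq_1 A, ← mul_div_mul_right _ (autFactor A (moeb B τ)) hB, h]
  congr 1
  simp only [autFactor, Matrix.SpecialLinearGroup.coe_mul, Matrix.mul_apply, Fin.sum_univ_two]
  push_cast; ring

/-- The only nonformal point is the cocycle identity for the shift of `t`, which rests on `det B =
1`. -/
theorem actOn_mul (A B : Matrix.SpecialLinearGroup (Fin 2) ℤ) (f : ℂ → ℂ → ℂ → ℂ → ℂ)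
    {τ z₁ z₂ t : ℂ} (hB : autFactor B τ ≠ 0) (hA : autFactor A (moeb B τ) ≠ 0) :
    actOn (A * B) f τ z₁ z₂ t = actOn B (actOn A f) τ z₁ z₂ t := by
  have hAB := autFactor_mul A B hB
  have hdet : (B 0 0 : ℂ) * B 1 1 - B 0 1 * B 1 0 = 1 := by
    have := B.det_coe
    rw [Matrix.det_fin_two] at this
    exact_mod_cast this
  have h10 : (((A * B) 1 0 : ℤ) : ℂ) = A 1 0 * B 0 0 + A 1 1 * B 1 0 := by
    simp only [Matrix.SpecialLinearGroup.coe_mul, Matrix.mul_apply, Fin.sum_univ_two]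
    push_cast; ring
  have hA' : autFactor A (moeb B τ) * autFactor B τ =
      (A 1 0 : ℤ) * ((B 0 0 : ℤ) * τ + (B 0 1 : ℤ)) + (A 1 1 : ℤ) * autFactor B τ := by
    rw [autFactor, moeb]; field_simp
  simp only [actOn]
  rw [moeb_mul A B hB, hAB, mul_comm (autFactor A _), ← div_div, ← div_div, h10]
  congr 1
  have hBd : autFactor B τ = B 1 0 * τ + B 1 1 := rfl
  generalize autFactor A (moeb B τ) = α at *
  generalize autFactor B τ = β at *
  have key : (B 1 0 : ℂ) * (α * β) + A 1 0 = (A 1 0 * B 0 0 + A 1 1 * B 1 0) * β := by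
    rw [hA', hBd]
    linear_combination (-(A 1 0 : ℂ)) * hdet
  field_simp
  linear_combination (z₁ * z₂) * key

theorem Preserves.mul {M m s : ℕ} {A B : Matrix.SpecialLinearGroup (Fin 2) ℤ}
    (hA : Preserves M m s A) (hB : Preserves M m s B) : Preserves M m s (A * B) where
  ne_zero τ hτ := by
    rw [autFactor_mul A B (hB.ne_zero τ hτ)]
    exact mul_ne_zero (hA.ne_zero _ (hB.im_pos τ hτ)) (hB.ne_zero τ hτ)
  im_pos τ hτ := by
    rw [moeb_mul A B (hB.ne_zero τ hτ)]
    exact hA.im_pos _ (hB.im_pos τ hτ)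
  regular τ z₁ z₂ hτ hr := by
    rw [moeb_mul A B (hB.ne_zero τ hτ),
      autFactor_mul A B (hB.ne_zero τ hτ), mul_comm (autFactor A _), ← div_div, ← div_div]
    exact hA.regular _ _ _ (hB.im_pos τ hτ) (hB.regular τ z₁ z₂ hτ hr)
  span f hf := (hB.span _ (hA.span f hf)).congr fun τ z₁ z₂ t hτ _ =>
    actOn_mul A B f (hB.ne_zero τ hτ) (hA.ne_zero _ (hB.im_pos τ hτ))

theorem AllRegular.S {τ z₁ z₂ : ℂ} (hτ : τ ≠ 0) (h : AllRegular τ z₁ z₂) :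
    AllRegular (-1 / τ) (z₁ / τ) (z₂ / τ) := by
  intro δ hδ δ' hδ'
  obtain ⟨e, he⟩ := exists_int_two_mul hδ'
  obtain ⟨h1, h2, h3⟩ := h δ' hδ' δ hδ
  have hJ : δ' + δ' = e := by rw [← he]; ring
  refine ⟨not_inLattice_S hτ hJ h1, not_inLattice_S hτ hJ h2, fun hc => h3 ?_⟩
  rw [← add_div] at hc
  exact inLattice_S hτ hc

theorem AllRegular.T {τ z₁ z₂ : ℂ} (h : AllRegular τ z₁ z₂) : AllRegular (τ + 1) z₁ z₂ := by
  intro δ hδ δ' hδ'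
  obtain ⟨hm, d, hd⟩ := exists_int_add_eq hδ hδ'
  obtain ⟨h1, h2, h3⟩ := h _ hm δ' hδ'
  have hc : δ' = δ' + (0 : ℤ) := by simp
  exact ⟨not_inLattice_T hc hd h1, not_inLattice_T hc hd h2, fun hc => h3 (inLattice_T hc)⟩

theorem preserves_S {M m : ℕ} (s : ℕ) (hM : 0 < M) (hcop : Nat.Coprime M (m + 1)) :
    Preserves M m s S := by
  have haut : ∀ τ, autFactor S τ = τ := fun τ => by simp [autFactor, S]
  have hmoeb : ∀ τ, moeb S τ = -1 / τ := fun τ => by rw [moeb, haut]; simp [S]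
  have h10 : ((S 1 0 : ℤ) : ℂ) = 1 := by simp [S]
  have hne : ∀ τ : ℂ, 0 < τ.im → τ ≠ 0 := by rintro τ hτ rfl; simp at hτ
  have him : ∀ τ : ℂ, 0 < τ.im → 0 < (moeb S τ).im := fun τ hτ => by
    rw [hmoeb]; exact S_im_pos hτ
  have hreg : ∀ τ z₁ z₂ : ℂ, 0 < τ.im → AllRegular τ z₁ z₂ →
      AllRegular (moeb S τ) (z₁ / autFactor S τ) (z₂ / autFactor S τ) := fun τ z₁ z₂ hτ h => by
    rw [hmoeb, haut]; exact h.S (hne τ hτ)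
  refine ⟨fun τ hτ => by rw [haut]; exact hne τ hτ, him, hreg,
    Preserves.span_of_generators him hreg fun ε hε ε' hε' j hj k hk => ?_⟩
  refine InSpan.congr (((InSpan.sum (indices M ε) fun a ha => InSpan.sum (indices M ε) fun b hb =>
    (inSpan_chTilde M m s hε' hε ha hb).mul_left
      (Complex.exp (-(2 * (Real.pi : ℂ) * Complex.I * ((m : ℂ) + 1) / (M : ℂ))
        * ((a : ℂ) * (k : ℂ) + (b : ℂ) * (j : ℂ))))).mul_left
    ((-1 : ℂ) ^ (4 * (ε : ℂ) * (ε' : ℂ)) * (1 / (M : ℂ))))) fun τ z₁ z₂ t hτ hr => ?_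
  rw [actOn, hmoeb, haut, h10, one_mul]
  exact chTilde_S s hM hcop hε hε' hj hk t hτ (hr ε' hε' ε hε)

theorem preserves_T {M : ℕ} (m s : ℕ) (hM : 0 < M) : Preserves M m s T := by
  have haut : ∀ τ, autFactor T τ = 1 := fun τ => by simp [autFactor, T]
  have hmoeb : ∀ τ, moeb T τ = τ + 1 := fun τ => by rw [moeb, haut]; simp [T]
  have h10 : ((T 1 0 : ℤ) : ℂ) = 0 := by simp [T]
  have him : ∀ τ : ℂ, 0 < τ.im → 0 < (moeb T τ).im := fun τ hτ => by
    rw [hmoeb]; simpa using hτ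
  have hreg : ∀ τ z₁ z₂ : ℂ, 0 < τ.im → AllRegular τ z₁ z₂ →
      AllRegular (moeb T τ) (z₁ / autFactor T τ) (z₂ / autFactor T τ) := fun τ z₁ z₂ hτ h => by
    rw [hmoeb, haut, div_one, div_one]; exact h.T
  refine ⟨fun τ hτ => by rw [haut]; exact one_ne_zero, him, hreg,
    Preserves.span_of_generators him hreg fun ε hε ε' hε' j hj k hk => ?_⟩
  refine InSpan.congr ((inSpan_chTilde M m s (exists_int_add_eq hε hε').1 hε' hj hk).mul_left
    (Complex.exp (2 * (Real.pi : ℂ) * Complex.I * (((m : ℂ) + 1) * (j : ℂ) * (k : ℂ) / (M : ℂ))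
      - (Real.pi : ℂ) * Complex.I * (ε' : ℂ)))) fun τ z₁ z₂ t hτ hr => ?_
  rw [actOn, hmoeb, haut, h10, div_one, div_one, zero_mul, zero_mul, zero_div, sub_zero]
  exact chTilde_T s hM hε hε' hj hk t hτ (hr _ (exists_int_add_eq hε hε').1 ε' hε')

/-- `Preserves` is known to be closed under products only. As `S⁴ = 1` and `(ST)³ = S²`, the
inverses of the generators are products of `S` and `T`; the induction then tracks `A` and `A⁻¹`
together. -/
theorem preserves_all {M m : ℕ} (s : ℕ) (hM : 0 < M) (hcop : Nat.Coprime M (m + 1))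
    (A : Matrix.SpecialLinearGroup (Fin 2) ℤ) : Preserves M m s A := by
  have hS := preserves_S s hM hcop
  have hT := preserves_T m s hM
  have hS' : Preserves M m s S⁻¹ := by
    have : (S⁻¹ : Matrix.SpecialLinearGroup (Fin 2) ℤ) = S * S * S := by decide
    rw [this]; exact (hS.mul hS).mul hS
  have hT' : Preserves M m s T⁻¹ := by
    have : (T⁻¹ : Matrix.SpecialLinearGroup (Fin 2) ℤ) = S * T * S * T * S⁻¹ := by decide
    rw [this]; exact (((hS.mul hT).mul hS).mul hT).mul hS'
  have hmem : A ∈ Subgroup.closure {S, T} := by simp [SpecialLinearGroup.SL2Z_generators]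
  have h : Preserves M m s A ∧ Preserves M m s A⁻¹ := by
    induction hmem using Subgroup.closure_induction with
    | mem x hx =>
      rcases hx with rfl | hx
      · exact ⟨hS, hS'⟩
      · rw [Set.mem_singleton_iff.1 hx]
        exact ⟨hT, hT'⟩
    | one =>
      have : Preserves M m s 1 := by
        have h1 := hS.mul hS'
        rwa [mul_inv_cancel] at h1
      exact ⟨this, by rwa [inv_one]⟩
    | mul x y _ _ hx hy =>
      exact ⟨hx.1.mul hy.1, by rw [mul_inv_rev]; exact hy.2.mul hx.2⟩
    | inv x _ hx => exact ⟨hx.2, by rw [inv_inv]; exact hx.1⟩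
  exact h.1

theorem coprime_of_gcd {M m : ℕ} (hgcd : 0 < m → Nat.gcd M (2 * m + 2) = 1) :
    Nat.Coprime M (m + 1) := by
  rcases Nat.eq_zero_or_pos m with rfl | hm
  · simp
  · have h : Nat.Coprime M (2 * m + 2) := hgcd hm
    exact h.coprime_dvd_right ⟨2, by ring⟩

end SL21

end

theorem theorem2p9 (M m s : ℕ) (hM : 0 < M) (hgcd : 0 < m → Nat.gcd M (2 * m + 2) = 1)
    (hs : s ≤ m) :
    -- the transformation `τ ↦ -1/τ`
    (∀ ε ∈ SL21.halves, ∀ ε' ∈ SL21.halves,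
      ∀ j ∈ SL21.indices M ε', ∀ k ∈ SL21.indices M ε',
      ∀ τ z₁ z₂ t : ℂ, 0 < τ.im → SL21.IsRegular ε' ε τ z₁ z₂ →
        SL21.chTilde M m s ε ε' j k (-1 / τ) (z₁ / τ) (z₂ / τ) (t - z₁ * z₂ / τ) =
          (-1 : ℂ) ^ (4 * (ε : ℂ) * (ε' : ℂ)) * (1 / (M : ℂ)) *
            ∑ a ∈ SL21.indices M ε, ∑ b ∈ SL21.indices M ε,
              Complex.exp (-(2 * (Real.pi : ℂ) * Complex.I * ((m : ℂ) + 1) / (M : ℂ))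
                  * ((a : ℂ) * (k : ℂ) + (b : ℂ) * (j : ℂ))) *
                SL21.chTilde M m s ε' ε a b τ z₁ z₂ t) ∧
    -- the transformation `τ ↦ τ + 1`
    (∀ ε ∈ SL21.halves, ∀ ε' ∈ SL21.halves,
      ∀ j ∈ SL21.indices M ε', ∀ k ∈ SL21.indices M ε',
      ∀ τ z₁ z₂ t : ℂ, 0 < τ.im → SL21.IsRegular |ε - ε'| ε' τ z₁ z₂ →
        SL21.chTilde M m s ε ε' j k (τ + 1) z₁ z₂ t =
          Complex.exp (2 * (Real.pi : ℂ) * Complex.I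
                * (((m : ℂ) + 1) * (j : ℂ) * (k : ℂ) / (M : ℂ))
              - (Real.pi : ℂ) * Complex.I * (ε' : ℂ)) *
            SL21.chTilde M m s |ε - ε'| ε' j k τ z₁ z₂ t) ∧
    -- the span of the family is invariant under `SL₂(ℤ)`
    (∀ A : Matrix.SpecialLinearGroup (Fin 2) ℤ,
      ∀ ε ∈ SL21.halves, ∀ ε' ∈ SL21.halves,
      ∀ j ∈ SL21.indices M ε', ∀ k ∈ SL21.indices M ε',
      ∃ C : ℝ → ℝ → ℝ → ℝ → ℂ, ∀ τ z₁ z₂ t : ℂ, 0 < τ.im →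
        (∀ δ ∈ SL21.halves, ∀ δ' ∈ SL21.halves, SL21.IsRegular δ δ' τ z₁ z₂) →
        SL21.chTilde M m s ε ε' j k
            (((A 0 0 : ℤ) * τ + (A 0 1 : ℤ)) / ((A 1 0 : ℤ) * τ + (A 1 1 : ℤ)))
            (z₁ / ((A 1 0 : ℤ) * τ + (A 1 1 : ℤ)))
            (z₂ / ((A 1 0 : ℤ) * τ + (A 1 1 : ℤ)))
            (t - (A 1 0 : ℤ) * z₁ * z₂ / ((A 1 0 : ℤ) * τ + (A 1 1 : ℤ))) =
          ∑ δ ∈ SL21.halves, ∑ δ' ∈ SL21.halves,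
            ∑ a ∈ SL21.indices M δ', ∑ b ∈ SL21.indices M δ',
              C δ δ' a b * SL21.chTilde M m s δ δ' a b τ z₁ z₂ t) := by
  have hcop := SL21.coprime_of_gcd hgcd
  refine ⟨fun ε hε ε' hε' j hj k hk τ z₁ z₂ t hτ hr =>
      SL21.chTilde_S s hM hcop hε hε' hj hk t hτ hr,
    fun ε hε ε' hε' j hj k hk τ z₁ z₂ t hτ hr => SL21.chTilde_T s hM hε hε' hj hk t hτ hr,
    fun A ε hε ε' hε' j hj k hk => ?_⟩
  exact (SL21.preserves_all s hM hcop A).span _ (SL21.inSpan_chTilde M m s hε hε' hj hk)
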